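/- **Setting.** Consider functions of two infinite families of complex times $\mathrm t=(t_1,t_2,\dots)$, $\bar{\mathrm t}=(\bar t_1,\bar t_2,\dots)$ and the Miwa shifts $\mathbb T_\xi f(\mathrm t,\bar{\mathrm t})=f(t_j+i\xi^j/j,\bar t_k)$, $\overline{\mathbb T}_\eta f(\mathrm t,\bar{\mathrm t})=f(t_j,\bar t_k+i\eta^k/k)$. Put $G(\xi)=1+\xi(\mathbb T_\xi U)V$ and $g(\eta)=1+\eta(\overline{\mathbb T}_\eta u)v$. A pair $(U,V)$ solves the *extended derivative nonlinear Schrödinger hierarchy* (extended DNLSH) if there are $u,v$ such that, for all sufficiently small complex $\xi,\xi_1,\xi_2,\eta,\eta_1,\eta_2$ (with $\mathbb T_j=\mathbb T_{\xi_j}$, $G_j=G(\xi_j)$, $\overline{\mathbb T}_j=\overline{\mathbb T}_{\eta_j}$, $g_j=g(\eta_j)$), at all times where the functions involved are defined, - $(\xi_1G_2-\xi_2G_1)\,\mathbb T_1\mathbb T_2U-\xi_1\mathbb T_1U+\xi_2\mathbb T_2U=0$ and $\bigl(\xi_1\mathbb T_1G_2-\xi_2\mathbb T_2G_1\bigr)V-\xi_1\mathbb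 T_2V+\xi_2\mathbb T_1V=0$; - $(\eta_1g_2-\eta_2g_1)\,\overline{\mathbb T}_1\overline{\mathbb T}_2u-\eta_1\overline{\mathbb T}_1u+\eta_2\overline{\mathbb T}_2u=0$ and $\bigl(\eta_1\overline{\mathbb T}_1g_2-\eta_2\overline{\mathbb T}_2g_1\bigr)v-\eta_1\overline{\mathbb T}_2v+\eta_2\overline{\mathbb T}_1v=0$; - $g(\eta)\overline{\mathbb T}_\eta U-U=\eta\,\overline{\mathbb T}_\eta u$, $\ g(\eta)V-\overline{\mathbb T}_\eta V=\eta v$, $\ G(\xi)\mathbb T_\xi u-u=\xi\,\mathbb T_\xi U$, $\ G(\xi)v-\mathbb T_\xi v=\xi V$. **Data.** Let $N\ge 0$, $\mu\in\mathbb R\setminus\{0,\pm1\}$, $U^{(0)}\in\mathbb C\setminus\{0\}$, $c=|U^{(0)}|^{-2}$, and let $\theta_1,\dots,\theta_N\in\mathbb R$ satisfy $\sin\frac{\theta_m+\theta_n}2\ne0$ for all $m,n$ (including $m=n$). Let $\alpha,\beta$ be real functions near $0$, continuous at $0$, with $$\alpha(\xi)+\alpha(\xi)^{-1}=\mu+\mu^{-1}+c\mu\,\xi^{-1}\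 (\xi\ne0),\quad\alpha(0)=0;\qquad \beta(\eta)+\beta(\eta)^{-1}=\mu+\mu^{-1}+c\mu\,\eta,\quad\beta(0)=\mu,$$ and let the real numbers $\nu_{nk},\tilde\nu_{nk},\varphi_k,\tilde\varphi_k$ be given by the expansions, for small real $\xi,\eta$, $$\sum_{k\ge1}\nu_{nk}\tfrac{\xi^k}k=2\arg\bigl[1-\alpha(\xi)e^{-i\theta_n}\bigr],\qquad \sum_{k\ge1}\tilde\nu_{nk}\tfrac{\eta^k}k=2\arg\bigl[1-\beta(\eta)e^{-i\theta_n}\bigr]-2\arg\bigl[1-\mu e^{-i\theta_n}\bigr],$$ $$\sum_{k\ge1}\varphi_k\tfrac{\xi^k}k=-\ln\bigl[1-\mu^{-1}\alpha(\xi)\bigr],\qquad \sum_{k\ge1}\tilde\varphi_k\tfrac{\eta^k}k=\ln\bigl|1-\mu^{-1}\beta(\eta)^{-1}\bigr|-\ln\bigl|1-\mu^{-2}\bigr|.$$ Set $\nu_n=\sum_{k\ge1}(\nu_{nk}t_k+\tilde\nu_{nk}\bar t_k)$ and $\varphi=\sum_{k\ge1}(\varphi_kt_k+\tilde\varphi_k\bar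 t_k)$ at the times where all these series converge absolutely, $\gamma^{(2)}_n=\arg(1-\mu e^{i\theta_n})$, $\gamma^{(1)}_n=2\theta_n-\gamma^{(2)}_n$, and for arbitrary real constants $C^{(0)}_1,\dots,C^{(0)}_N$ $$\Delta_\ell=\det\Bigl(\delta_{mn}+C^{(0)}_n\frac{\exp[\nu_n+i\gamma^{(\ell)}_n]}{\sin\frac{\theta_m+\theta_n}2}\Bigr)_{m,n=1}^N\quad(\ell=1,2),\qquad U=U^{(0)}e^{i\varphi}\,\frac{\Delta_1}{\Delta_2}.$$ **Proposition.** Such $\alpha,\beta,\nu_{nk},\tilde\nu_{nk},\varphi_k,\tilde\varphi_k$ exist, and for every such choice: 1. Let $V=U^*$, i.e. $V$ is the complex conjugate of $U$ at real times, continued to complex times by $V(\mathrm t,\bar{\mathrm t})=\overline{U(\mathrm t^*,\bar{\mathrm t}^*)}$. Let $D$ be the set of times at which the series converge and the denominators of $U$ and $V$ do not vanish. Every point of $D$ stays in $D$ under any two sufficiently small Miwa shifts, and $(U,V)$ solves the extended DNLSH on $D$: for some $u,v$, with $v=u^*$ at real times, and some $r>0$, the above equations hold for all shift parameters of modulus less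 than $r$ at every point of $D$ whose shifts occurring in the equation lie in $D$. 2. If moreover $\sin\frac{\theta_m-\theta_n}2\neq0$ for $m\ne n$, then $U$ satisfies non-vanishing boundary conditions: there are constants $w_\pm$ with $|w_\pm|=1$ such that at all real times (where the series converge) $U/(U^{(0)}e^{i\varphi})\to w_\pm$ as $t_1\to\pm\infty$ with the other times fixed; in particular $|U|\to|U^{(0)}|$. -/

import Mathlib

namespace DNLS

/-- The two infinite families of (complex) times of the extended hierarchy:
`pos j` is `t_{j+1}` and `neg k` is `t̄_{k+1}`. -/
structure Times where
  pos : ℕ → ℂ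
  neg : ℕ → ℂ

/-- Complex conjugation of all times; the fixed points are the real times. -/
def Times.conj (p : Times) : Times where
  pos j := starRingEnd ℂ (p.pos j)
  neg k := starRingEnd ℂ (p.neg k)

def Times.IsReal (p : Times) : Prop := p.conj = p

/-- Translation `t₁ ↦ t₁ + x` in the first positive time. -/
noncomputable def Times.addFirst (x : ℝ) (p : Times) : Times where
  pos j := p.pos j + if j = 0 then (x : ℂ) else 0
  neg := p.neg

/-- The positive Miwa shift `t_j ↦ t_j + i ξ^j / j`. -/
noncomputable def shiftPos (ξ : ℂ) (p : Times) : Times where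
  pos j := p.pos j + Complex.I * ξ ^ (j + 1) / ((j : ℂ) + 1)
  neg := p.neg

/-- The negative Miwa shift `t̄_k ↦ t̄_k + i η^k / k`. -/
noncomputable def shiftNeg (η : ℂ) (p : Times) : Times where
  pos := p.pos
  neg k := p.neg k + Complex.I * η ^ (k + 1) / ((k : ℂ) + 1)

/-- `G(ξ) = 1 + ξ (T_ξ U) V`. -/
noncomputable def bigG (U V : Times → ℂ) (ξ : ℂ) (p : Times) : ℂ :=
  1 + ξ * U (shiftPos ξ p) * V p

/-- `g(η) = 1 + η (T̄_η u) v`. -/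
noncomputable def smallG (u v : Times → ℂ) (η : ℂ) (p : Times) : ℂ :=
  1 + η * u (shiftNeg η p) * v p

/-- The functional equations of the extended DNLS hierarchy (positive, negative and mixed
subhierarchies) for functions `U, V, u, v` defined on a set `D` of times: they hold for all shift
parameters of modulus less than `r`, at every point of `D` whose shifts that occur are in `D`. -/
structure IsExtendedDNLSH (D : Set Times) (r : ℝ) (U V u v : Times → ℂ) : Prop where
  pos_U : ∀ ξ₁ ξ₂ : ℂ, ‖ξ₁‖ < r → ‖ξ₂‖ < r → ∀ p ∈ D, shiftPos ξ₁ p ∈ D → shiftPos ξ₂ p ∈ D →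
    shiftPos ξ₁ (shiftPos ξ₂ p) ∈ D →
    (ξ₁ * bigG U V ξ₂ p - ξ₂ * bigG U V ξ₁ p) * U (shiftPos ξ₁ (shiftPos ξ₂ p))
      - ξ₁ * U (shiftPos ξ₁ p) + ξ₂ * U (shiftPos ξ₂ p) = 0
  pos_V : ∀ ξ₁ ξ₂ : ℂ, ‖ξ₁‖ < r → ‖ξ₂‖ < r → ∀ p ∈ D, shiftPos ξ₁ p ∈ D → shiftPos ξ₂ p ∈ D →
    shiftPos ξ₁ (shiftPos ξ₂ p) ∈ D →
    (ξ₁ * bigG U V ξ₂ (shiftPos ξ₁ p) - ξ₂ * bigG U V ξ₁ (shiftPos ξ₂ p)) * V p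
      - ξ₁ * V (shiftPos ξ₂ p) + ξ₂ * V (shiftPos ξ₁ p) = 0
  neg_u : ∀ η₁ η₂ : ℂ, ‖η₁‖ < r → ‖η₂‖ < r → ∀ p ∈ D, shiftNeg η₁ p ∈ D → shiftNeg η₂ p ∈ D →
    shiftNeg η₁ (shiftNeg η₂ p) ∈ D →
    (η₁ * smallG u v η₂ p - η₂ * smallG u v η₁ p) * u (shiftNeg η₁ (shiftNeg η₂ p))
      - η₁ * u (shiftNeg η₁ p) + η₂ * u (shiftNeg η₂ p) = 0
  neg_v : ∀ η₁ η₂ : ℂ, ‖η₁‖ < r → ‖η₂‖ < r → ∀ p ∈ D, shiftNeg η₁ p ∈ D → shiftNeg η₂ p ∈ D →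
    shiftNeg η₁ (shiftNeg η₂ p) ∈ D →
    (η₁ * smallG u v η₂ (shiftNeg η₁ p) - η₂ * smallG u v η₁ (shiftNeg η₂ p)) * v p
      - η₁ * v (shiftNeg η₂ p) + η₂ * v (shiftNeg η₁ p) = 0
  mixed_U : ∀ η : ℂ, ‖η‖ < r → ∀ p ∈ D, shiftNeg η p ∈ D →
    smallG u v η p * U (shiftNeg η p) - U p = η * u (shiftNeg η p)
  mixed_V : ∀ η : ℂ, ‖η‖ < r → ∀ p ∈ D, shiftNeg η p ∈ D →
    smallG u v η p * V p - V (shiftNeg η p) = η * v p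
  mixed_u : ∀ ξ : ℂ, ‖ξ‖ < r → ∀ p ∈ D, shiftPos ξ p ∈ D →
    bigG U V ξ p * u (shiftPos ξ p) - u p = ξ * U (shiftPos ξ p)
  mixed_v : ∀ ξ : ℂ, ‖ξ‖ < r → ∀ p ∈ D, shiftPos ξ p ∈ D →
    bigG U V ξ p * v p - v (shiftPos ξ p) = ξ * V p

/-- The functions `α, β` and the coefficients `ν_{n,k+1}`, `ν̃_{n,k+1}`, `φ_{k+1}`, `φ̃_{k+1}`
(at index `k`) of the linear phases. They are pinned down by `IsDispersion`. -/
structure Dispersion (N : ℕ) where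
  alpha : ℝ → ℝ
  beta : ℝ → ℝ
  nu : Fin N → ℕ → ℝ
  nuBar : Fin N → ℕ → ℝ
  phi : ℕ → ℝ
  phiBar : ℕ → ℝ

/-- The equations that determine (near `0`) `α` and `β`, and the generating series that determine
the coefficients of the phases. Here `c` is the amplitude constant. -/
structure IsDispersion {N : ℕ} (μ c : ℝ) (θ : Fin N → ℝ) (d : Dispersion N) : Prop where
  alpha_continuousAt : ContinuousAt d.alpha 0
  alpha_zero : d.alpha 0 = 0
  alpha_eq : ∀ᶠ ξ in nhdsWithin (0 : ℝ) {0}ᶜ,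
    d.alpha ξ ≠ 0 ∧ d.alpha ξ + (d.alpha ξ)⁻¹ = μ + μ⁻¹ + c * μ * ξ⁻¹
  beta_continuousAt : ContinuousAt d.beta 0
  beta_zero : d.beta 0 = μ
  beta_eq : ∀ᶠ η in nhds (0 : ℝ),
    d.beta η ≠ 0 ∧ d.beta η + (d.beta η)⁻¹ = μ + μ⁻¹ + c * μ * η
  nu_series : ∀ n, ∀ᶠ ξ in nhds (0 : ℝ),
    HasSum (fun k : ℕ => d.nu n k * ξ ^ (k + 1) / ((k : ℝ) + 1))
      (2 * Complex.arg (1 - d.alpha ξ * Complex.exp (-Complex.I * θ n)))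
  nuBar_series : ∀ n, ∀ᶠ η in nhds (0 : ℝ),
    HasSum (fun k : ℕ => d.nuBar n k * η ^ (k + 1) / ((k : ℝ) + 1))
      (2 * Complex.arg (1 - d.beta η * Complex.exp (-Complex.I * θ n))
        - 2 * Complex.arg (1 - μ * Complex.exp (-Complex.I * θ n)))
  phi_series : ∀ᶠ ξ in nhds (0 : ℝ),
    HasSum (fun k : ℕ => d.phi k * ξ ^ (k + 1) / ((k : ℝ) + 1))
      (-Real.log (1 - μ⁻¹ * d.alpha ξ))
  phiBar_series : ∀ᶠ η in nhds (0 : ℝ),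
    HasSum (fun k : ℕ => d.phiBar k * η ^ (k + 1) / ((k : ℝ) + 1))
      (Real.log (1 - μ⁻¹ * (d.beta η)⁻¹) - Real.log (1 - (μ ^ 2)⁻¹))

/-- The times at which the series for all phases converge. -/
def convergenceDomain {N : ℕ} (d : Dispersion N) : Set Times :=
  {p | (Summable fun k : ℕ => (d.phi k : ℂ) * p.pos k + (d.phiBar k : ℂ) * p.neg k) ∧
    ∀ n, Summable fun k : ℕ => (d.nu n k : ℂ) * p.pos k + (d.nuBar n k : ℂ) * p.neg k}

/-- `φ(t, t̄)`. -/
noncomputable def phase {N : ℕ} (d : Dispersion N) (p : Times) : ℂ :=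
  ∑' k : ℕ, ((d.phi k : ℂ) * p.pos k + (d.phiBar k : ℂ) * p.neg k)

/-- `ν_n(t, t̄)`. -/
noncomputable def solitonPhase {N : ℕ} (d : Dispersion N) (n : Fin N) (p : Times) : ℂ :=
  ∑' k : ℕ, ((d.nu n k : ℂ) * p.pos k + (d.nuBar n k : ℂ) * p.neg k)

/-- `γ_n⁽²⁾ = arg (1 - μ e^{iθ_n})`. -/
noncomputable def gammaTwo {N : ℕ} (μ : ℝ) (θ : Fin N → ℝ) (n : Fin N) : ℝ :=
  Complex.arg (1 - μ * Complex.exp (Complex.I * θ n))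

/-- `γ_n⁽¹⁾ = 2 θ_n - γ_n⁽²⁾`. -/
noncomputable def gammaOne {N : ℕ} (μ : ℝ) (θ : Fin N → ℝ) (n : Fin N) : ℝ :=
  2 * θ n - gammaTwo μ θ n

/-- The determinant `Δ` with constant phases `γ_n`. -/
noncomputable def solitonDet {N : ℕ} (θ C γ : Fin N → ℝ) (d : Dispersion N) (p : Times) : ℂ :=
  Matrix.det (Matrix.of fun m n : Fin N =>
    (if m = n then (1 : ℂ) else 0) +
      (C n : ℂ) * Complex.exp (solitonPhase d n p + Complex.I * γ n) /
        (Real.sin ((θ m + θ n) / 2) : ℂ))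

/-- `Δ₁`. -/
noncomputable def deltaOne {N : ℕ} (μ : ℝ) (θ C : Fin N → ℝ) (d : Dispersion N) (p : Times) : ℂ :=
  solitonDet θ C (gammaOne μ θ) d p

/-- `Δ₂`. -/
noncomputable def deltaTwo {N : ℕ} (μ : ℝ) (θ C : Fin N → ℝ) (d : Dispersion N) (p : Times) : ℂ :=
  solitonDet θ C (gammaTwo μ θ) d p

/-- The `N`-soliton function `U = U₀ e^{iφ} Δ₁ / Δ₂`. -/
noncomputable def solitonU {N : ℕ} (μ : ℝ) (U₀ : ℂ) (θ C : Fin N → ℝ) (d : Dispersion N)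
    (p : Times) : ℂ :=
  U₀ * Complex.exp (Complex.I * phase d p) * (deltaOne μ θ C d p / deltaTwo μ θ C d p)

/-- The continuation to complex times of the complex conjugate `f*` of a function of real times. -/
noncomputable def reflect (f : Times → ℂ) (p : Times) : ℂ := starRingEnd ℂ (f p.conj)

/-- The times at which the series converge and neither `U` nor `U*` has a vanishing denominator
(at real times: `Δ₂ ≠ 0`). -/
def regularDomain {N : ℕ} (μ : ℝ) (θ C : Fin N → ℝ) (d : Dispersion N) : Set Times :=
  {p | p ∈ convergenceDomain d ∧ deltaTwo μ θ C d p ≠ 0 ∧ deltaTwo μ θ C d p.conj ≠ 0}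

/-- Every point of `D` stays in `D` under any two sufficiently small Miwa shifts. -/
def IsShiftStable (D : Set Times) : Prop :=
  ∀ p ∈ D, ∀ᶠ q : ℂ × ℂ in nhds (0, 0),
    shiftPos q.1 (shiftPos q.2 p) ∈ D ∧ shiftNeg q.1 (shiftNeg q.2 p) ∈ D ∧
      shiftPos q.1 (shiftNeg q.2 p) ∈ D

/-- Non-vanishing boundary conditions: along the real `t₁`-axis, `U` is asymptotic to the plane wave
`U₀ e^{iφ}` up to a constant phase factor at each end (so `|U| → |U₀|`). -/
def HasNonvanishingBoundary {N : ℕ} (U₀ : ℂ) (d : Dispersion N) (U : Times → ℂ) : Prop :=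
  ∃ wPlus wMinus : ℂ, ‖wPlus‖ = 1 ∧ ‖wMinus‖ = 1 ∧
    ∀ p ∈ convergenceDomain d, p.IsReal →
      Filter.Tendsto (fun x : ℝ => U (p.addFirst x) /
        (U₀ * Complex.exp (Complex.I * phase d (p.addFirst x)))) Filter.atTop (nhds wPlus) ∧
      Filter.Tendsto (fun x : ℝ => U (p.addFirst x) /
        (U₀ * Complex.exp (Complex.I * phase d (p.addFirst x)))) Filter.atBot (nhds wMinus)

end DNLS

/-!
Both fields are quotients of shifted tau functions `τ(X) = det (1 + A diag X)` with
`A m n = 1 / sin ((θ m + θ n) / 2)`, and a Miwa shift multiplies `X n` by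
`(1 - a e^{-iθ_n}) / (1 - a e^{iθ_n})`, where `a = α(ξ)` or `a = β(η)`. The matrix `A` has
displacement rank one with respect to the diagonal matrices of the `e^{iθ_n}` and the `e^{-iθ_n}`,
so that the shifted determinants satisfy a three-term Fay identity, and the equations for `U` and
`u` follow from four instances of it. The positive half belongs to the base points `(0, μ)` and the
negative half to `(μ, 0)`; exchanging them exchanges `U` with `u`. The reflection `a ↦ a⁻¹` of the
shift points gives the equations of `V` and `v` from those of `U` and `u`. As `t₁ → ±∞`, each
soliton exponential with a nonzero constant tends to infinity or to zero, and the quotient of the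
determinants tends to a product of unimodular numbers because the limiting Cauchy-type determinant
does not vanish.
-/

namespace DNLS

open Filter Topology Matrix ComplexConjugate

section Fay

theorem det_add_vecMulVec_add_vecMulVec {R ι : Type*} [CommRing R] [Fintype ι] [DecidableEq ι]
    {M : Matrix ι ι R} (hM : IsUnit M.det) (x₁ y₁ x₂ y₂ : ι → R) :
    (M + vecMulVec x₁ y₁ + vecMulVec x₂ y₂).det =
      M.det * ((1 + y₁ ⬝ᵥ M⁻¹ *ᵥ x₁) * (1 + y₂ ⬝ᵥ M⁻¹ *ᵥ x₂) -
        (y₁ ⬝ᵥ M⁻¹ *ᵥ x₂) * (y₂ ⬝ᵥ M⁻¹ *ᵥ x₁)) := by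
  have hsum : M + vecMulVec x₁ y₁ + vecMulVec x₂ y₂ = M + (of ![x₁, x₂])ᵀ * of ![y₁, y₂] := by
    ext m n
    simp [Matrix.mul_apply, Fin.sum_univ_two, vecMulVec_apply, add_assoc]
  have hentry (i j : Fin 2) : (of ![y₁, y₂] * M⁻¹ * (of ![x₁, x₂])ᵀ) i j =
      ![y₁, y₂] i ⬝ᵥ M⁻¹ *ᵥ ![x₁, x₂] j := by
    rw [Matrix.mul_assoc]
    rfl
  rw [hsum, det_add_mul _ _ hM, det_fin_two]
  simp only [Matrix.add_apply, hentry]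
  simp

variable {K : Type*} [Field K] {ι : Type*}

/-- The value at `t` of the linear form attached to the point `a = (a.1 : a.2)` of the projective
line; in the affine coordinate `a.1 / a.2` it is `1 - a t` up to a factor. -/
def lin (a : K × K) (t : K) : K := a.2 - a.1 * t

/-- The determinant of two points of the projective line. -/
def bracket (a b : K × K) : K := a.1 * b.2 - b.1 * a.2

/-- A point of the projective line is admissible if its linear form has neither a zero nor a pole
among the `p n` and `q n`. -/
def IsAdmissible (p q : ι → K) (a : K × K) : Prop := ∀ n, lin a (p n) ≠ 0 ∧ lin a (q n) ≠ 0

/-- The weights by which the shift attached to a point of the projective line multiplies the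
exponentials of a soliton tau function. -/
def shiftWeight (p q : ι → K) (a : K × K) (n : ι) : K := lin a (q n) / lin a (p n)

variable [Fintype ι] [DecidableEq ι]

/-- The point `a` of the projective line dressed by the resolvent of a matrix of displacement rank
one. Dressing turns the shifted determinants into brackets, so that the Fay identity becomes the
Plücker relation between four points. -/
noncomputable def dressedPoint (M : Matrix ι ι K) (p q x y : ι → K) (a : K × K) : K × K :=
  (a.1 + a.1 ^ 2 * ((fun n => y n / lin a (p n)) ⬝ᵥ M⁻¹ *ᵥ x),
    a.2 + a.1 ^ 2 * ((fun n => y n / lin a (p n)) ⬝ᵥ M⁻¹ *ᵥ (q * x)))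

variable {A : Matrix ι ι K} {p q x y : ι → K} {a b c d : K × K}

theorem det_add_mul_shiftWeight_eq (hA : ∀ m n, A m n * (p n - q m) = x m * y n)
    (ha : IsAdmissible p q a) (hb : IsAdmissible p q b) (z : K) :
    (scalar ι z + A * diagonal (shiftWeight p q a * shiftWeight p q b)).det =
      (scalar ι z + A + vecMulVec x (b.1 • fun n => y n / lin b (p n)) +
        vecMulVec (b.2 • x - b.1 • (q * x))
          (a.1 • fun n => y n / (lin a (p n) * lin b (p n)))).det := by
  have hD : (diagonal fun n => lin a (q n) * lin b (q n)).det ≠ 0 := by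
    rw [det_diagonal]
    exact Finset.prod_ne_zero_iff.2 fun n _ => mul_ne_zero (ha n).2 (hb n).2
  refine mul_right_cancel₀ hD ?_
  rw [mul_comm, ← det_mul, ← det_mul]
  congr 1
  ext m n
  have hz : lin a (q m) * lin b (q m) * scalar ι z m n =
      scalar ι z m n * (lin a (q n) * lin b (q n)) := by
    by_cases h : m = n
    · rw [h, mul_comm]
    · simp [h]
  have hp := (ha n).1
  have hp' := (hb n).1
  have hdisp := hA m n
  simp only [diagonal_mul, mul_diagonal, Matrix.add_apply, Pi.mul_apply, shiftWeight,
    vecMulVec_apply, Pi.smul_apply, Pi.sub_apply, smul_eq_mul]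
  rw [mul_add, hz]
  field_simp
  simp only [lin]
  linear_combination (a.2 - a.1 * q n) * (b.2 - b.1 * q n) *
    (b.1 * (a.2 - a.1 * p n) + a.1 * (b.2 - b.1 * q m)) * hdisp

theorem bracket_mul_det_add_mul_shiftWeight (hA : ∀ m n, A m n * (p n - q m) = x m * y n)
    (ha : IsAdmissible p q a) (hb : IsAdmissible p q b) {z : K}
    (hM : (scalar ι z + A).det ≠ 0) :
    bracket a b * (scalar ι z + A * diagonal (shiftWeight p q a * shiftWeight p q b)).det =
      (scalar ι z + A).det * bracket (dressedPoint (scalar ι z + A) p q x y a)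
        (dressedPoint (scalar ι z + A) p q x y b) := by
  set M := scalar ι z + A
  set ya := fun n => y n / lin a (p n)
  set yb := fun n => y n / lin b (p n)
  set yab := fun n => y n / (lin a (p n) * lin b (p n))
  have hyab : bracket a b • yab = a.1 • ya - b.1 • yb := by
    funext n
    have hp := (ha n).1
    have hp' := (hb n).1
    simp only [Pi.smul_apply, Pi.sub_apply, smul_eq_mul, ya, yb, yab]
    field_simp
    simp only [bracket, lin]
    ring
  have hyab_dot (v : ι → K) : bracket a b * (yab ⬝ᵥ M⁻¹ *ᵥ v) =
      a.1 * (ya ⬝ᵥ M⁻¹ *ᵥ v) - b.1 * (yb ⬝ᵥ M⁻¹ *ᵥ v) := by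
    rw [← smul_eq_mul, ← smul_dotProduct, hyab, sub_dotProduct, smul_dotProduct, smul_dotProduct,
      smul_eq_mul, smul_eq_mul]
  have hx := hyab_dot x
  have hqx := hyab_dot (q * x)
  rw [det_add_mul_shiftWeight_eq hA ha hb, det_add_vecMulVec_add_vecMulVec hM.isUnit]
  simp only [smul_dotProduct, mulVec_sub, mulVec_smul, dotProduct_sub, dotProduct_smul,
    smul_eq_mul, dressedPoint]
  simp only [bracket] at hx hqx ⊢
  linear_combination M.det * a.1 * ((1 + b.1 * (yb ⬝ᵥ M⁻¹ *ᵥ x)) * (b.2 * hx - b.1 * hqx) -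
    b.1 * (b.2 * (yb ⬝ᵥ M⁻¹ *ᵥ x) - b.1 * (yb ⬝ᵥ M⁻¹ *ᵥ (q * x))) * hx)

/-- The determinant `det (1 + A diag s)`, whose values at products of shift weights are the shifted
tau functions. -/
def tauDet (A : Matrix ι ι K) (s : ι → K) : K := (1 + A * diagonal s).det

theorem fay_identity [Infinite K] (hA : ∀ m n, A m n * (p n - q m) = x m * y n)
    (ha : IsAdmissible p q a) (hb : IsAdmissible p q b) (hc : IsAdmissible p q c)
    (hd : IsAdmissible p q d) :
    bracket a b * bracket c d * (tauDet A (shiftWeight p q a * shiftWeight p q b) *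
        tauDet A (shiftWeight p q c * shiftWeight p q d)) -
      bracket a c * bracket b d * (tauDet A (shiftWeight p q a * shiftWeight p q c) *
        tauDet A (shiftWeight p q b * shiftWeight p q d)) +
      bracket a d * bracket b c * (tauDet A (shiftWeight p q a * shiftWeight p q d) *
        tauDet A (shiftWeight p q b * shiftWeight p q c)) = 0 := by
  let P (s : ι → K) : Polynomial K := (-(A * diagonal s)).charpoly
  set S := shiftWeight p q
  have hP (s : ι → K) (z : K) : (P s).eval z = (scalar ι z + A * diagonal s).det := by
    rw [eval_charpoly, sub_neg_eq_add]
  -- The identity holds for `det (z + A diag s)` wherever the resolvent exists, hence for every `z`.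
  have hmul : (Polynomial.C (bracket a b * bracket c d) * (P (S a * S b) * P (S c * S d)) -
      Polynomial.C (bracket a c * bracket b d) * (P (S a * S c) * P (S b * S d)) +
      Polynomial.C (bracket a d * bracket b c) * (P (S a * S d) * P (S b * S c))) *
        (-A).charpoly = 0 := by
    refine Polynomial.funext fun z => ?_
    simp only [Polynomial.eval_mul, Polynomial.eval_add, Polynomial.eval_sub, Polynomial.eval_C,
      hP, eval_charpoly, sub_neg_eq_add, Polynomial.eval_zero]
    by_cases hM : (scalar ι z + A).det = 0
    · rw [hM, mul_zero]
    · rw [mul_mul_mul_comm, mul_mul_mul_comm (bracket a c), mul_mul_mul_comm (bracket a d),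
        bracket_mul_det_add_mul_shiftWeight hA ha hb hM,
        bracket_mul_det_add_mul_shiftWeight hA ha hc hM,
        bracket_mul_det_add_mul_shiftWeight hA ha hd hM,
        bracket_mul_det_add_mul_shiftWeight hA hb hc hM,
        bracket_mul_det_add_mul_shiftWeight hA hb hd hM,
        bracket_mul_det_add_mul_shiftWeight hA hc hd hM]
      simp only [bracket]
      ring
  have hzero := (mul_eq_zero.1 hmul).resolve_right (charpoly_monic _).ne_zero
  simpa only [Polynomial.eval_mul, Polynomial.eval_add, Polynomial.eval_sub, Polynomial.eval_C,
    hP, map_one, Polynomial.eval_zero, tauDet] using congrArg (Polynomial.eval 1) hzero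

end Fay

section Weight

variable {N : ℕ} {θ : Fin N → ℝ}

/-- The numbers `e^{iθ_n}`. -/
noncomputable def expPos (θ : Fin N → ℝ) (n : Fin N) : ℂ := Complex.exp (Complex.I * θ n)

/-- The numbers `e^{-iθ_n}`. -/
noncomputable def expNeg (θ : Fin N → ℝ) (n : Fin N) : ℂ := Complex.exp (-Complex.I * θ n)

theorem conj_expPos (θ : Fin N → ℝ) (n : Fin N) : conj (expPos θ n) = expNeg θ n := by
  simp [expNeg, expPos, ← Complex.exp_conj]

theorem conj_expNeg (θ : Fin N → ℝ) (n : Fin N) : conj (expNeg θ n) = expPos θ n := by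
  simp [expNeg, expPos, ← Complex.exp_conj]

theorem expPos_mul_expNeg (θ : Fin N → ℝ) (n : Fin N) : expPos θ n * expNeg θ n = 1 := by
  rw [expPos, expNeg, ← Complex.exp_add]
  simp

theorem norm_expPos (θ : Fin N → ℝ) (n : Fin N) : ‖expPos θ n‖ = 1 := by
  rw [expPos, mul_comm]
  exact Complex.norm_exp_ofReal_mul_I _

theorem norm_expNeg (θ : Fin N → ℝ) (n : Fin N) : ‖expNeg θ n‖ = 1 := by
  rw [← conj_expPos, RCLike.norm_conj, norm_expPos]

theorem lin_ne_zero {a : ℂ × ℂ} {t : ℂ} (ht : ‖t‖ = 1) (ha : ‖a.1‖ ≠ ‖a.2‖) : lin a t ≠ 0 := by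
  intro h
  apply ha
  rw [lin, sub_eq_zero] at h
  rw [h, norm_mul, ht, mul_one]

theorem isAdmissible_of_norm_ne (θ : Fin N → ℝ) {a : ℂ × ℂ} (ha : ‖a.1‖ ≠ ‖a.2‖) :
    IsAdmissible (expPos θ) (expNeg θ) a := fun n =>
  ⟨lin_ne_zero (norm_expPos θ n) ha, lin_ne_zero (norm_expNeg θ n) ha⟩

/-- The shift weights of the soliton tau function at a point of the projective line. -/
noncomputable def pointWeight (θ : Fin N → ℝ) (a : ℂ × ℂ) : Fin N → ℂ :=
  shiftWeight (expPos θ) (expNeg θ) a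

/-- The shift weights at the point with affine coordinate `a`. -/
noncomputable def weight (θ : Fin N → ℝ) (a : ℂ) : Fin N → ℂ := pointWeight θ (a, 1)

/-- The shift weights at the point with affine coordinate `a⁻¹`. -/
noncomputable def dualWeight (θ : Fin N → ℝ) (a : ℂ) : Fin N → ℂ := pointWeight θ (1, a)

/-- The weights that relate the two determinants in a field with base points `o` and `o'`; they are
the common ratio of `dualWeight θ o` to `weight θ o'` and of `dualWeight θ o'` to `weight θ o`. -/
noncomputable def crossWeight (θ : Fin N → ℝ) (o o' : ℂ) : Fin N → ℂ :=
  dualWeight θ 0 / (weight θ o * weight θ o')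

variable {a o o' : ℂ}

theorem weight_apply (θ : Fin N → ℝ) (a : ℂ) (n : Fin N) :
    weight θ a n = (1 - a * expNeg θ n) / (1 - a * expPos θ n) := rfl

theorem pointWeight_affine (θ : Fin N → ℝ) (a : ℂ) : pointWeight θ (a, 1) = weight θ a := rfl

theorem pointWeight_dual (θ : Fin N → ℝ) (a : ℂ) : pointWeight θ (1, a) = dualWeight θ a := rfl

theorem pointWeight_ne_zero (θ : Fin N → ℝ) {a : ℂ × ℂ} (ha : ‖a.1‖ ≠ ‖a.2‖) (n : Fin N) :
    pointWeight θ a n ≠ 0 :=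
  have h := isAdmissible_of_norm_ne θ ha n
  div_ne_zero h.2 h.1

theorem weight_ne_zero (θ : Fin N → ℝ) (ha : ‖a‖ ≠ 1) (n : Fin N) : weight θ a n ≠ 0 :=
  pointWeight_ne_zero θ (by simpa using ha) n

theorem dualWeight_ne_zero (θ : Fin N → ℝ) (ha : ‖a‖ ≠ 1) (n : Fin N) : dualWeight θ a n ≠ 0 :=
  pointWeight_ne_zero θ (by simpa using ha.symm) n

theorem weight_zero (θ : Fin N → ℝ) : weight θ 0 = 1 := by
  funext n
  simp [weight_apply]

theorem weight_mul_dualWeight (θ : Fin N → ℝ) (ha : ‖a‖ ≠ 1) :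
    weight θ a * dualWeight θ a = dualWeight θ 0 := by
  funext n
  have h₁ := (isAdmissible_of_norm_ne θ (a := (a, 1)) (by simpa using ha) n).1
  have h₂ := (isAdmissible_of_norm_ne θ (a := (1, a)) (by simpa using ha.symm) n).1
  have h₃ := (isAdmissible_of_norm_ne θ (a := (1, 0)) (by simp) n).1
  rw [Pi.mul_apply, weight, dualWeight, dualWeight, pointWeight, pointWeight, pointWeight,
    shiftWeight, shiftWeight, shiftWeight, div_mul_div_comm, div_eq_div_iff (mul_ne_zero h₁ h₂) h₃]
  simp only [lin]
  linear_combination a * (expPos θ n - expNeg θ n) * expPos_mul_expNeg θ n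

theorem crossWeight_comm (θ : Fin N → ℝ) (o o' : ℂ) :
    crossWeight θ o o' = crossWeight θ o' o := by
  rw [crossWeight, crossWeight, mul_comm]

theorem crossWeight_ne_zero (θ : Fin N → ℝ) (ho : ‖o‖ ≠ 1) (ho' : ‖o'‖ ≠ 1) (n : Fin N) :
    crossWeight θ o o' n ≠ 0 :=
  div_ne_zero (dualWeight_ne_zero θ (by simp) n)
    (mul_ne_zero (weight_ne_zero θ ho n) (weight_ne_zero θ ho' n))

theorem dualWeight_left (θ : Fin N → ℝ) (ho : ‖o‖ ≠ 1) (ho' : ‖o'‖ ≠ 1) :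
    dualWeight θ o = weight θ o' * crossWeight θ o o' := by
  funext n
  have h := weight_ne_zero θ ho n
  have h' := weight_ne_zero θ ho' n
  simp only [crossWeight, ← weight_mul_dualWeight θ ho, Pi.mul_apply, Pi.div_apply]
  field_simp

theorem dualWeight_right (θ : Fin N → ℝ) (ho : ‖o‖ ≠ 1) (ho' : ‖o'‖ ≠ 1) :
    dualWeight θ o' = weight θ o * crossWeight θ o o' := by
  rw [crossWeight_comm, dualWeight_left θ ho' ho]

end Weight

section Tau

variable {N : ℕ} {θ : Fin N → ℝ}

/-- The matrix of the cosecants of the half sums of the angles. -/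
noncomputable def cscMatrix (θ : Fin N → ℝ) : Matrix (Fin N) (Fin N) ℂ :=
  of fun m n => ((Real.sin ((θ m + θ n) / 2) : ℂ))⁻¹

/-- The `N`-soliton tau function with exponentials `X`. -/
noncomputable def solitonTau (θ : Fin N → ℝ) (X : Fin N → ℂ) : ℂ := tauDet (cscMatrix θ) X

theorem solitonTau_mul (Y s : Fin N → ℂ) :
    solitonTau θ (Y * s) = tauDet (cscMatrix θ * diagonal Y) s := by
  rw [solitonTau, tauDet, tauDet, Matrix.mul_assoc, diagonal_mul_diagonal]
  rfl

theorem sin_half_add_mul (θ : Fin N → ℝ) (m n : Fin N) :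
    (Real.sin ((θ m + θ n) / 2) : ℂ) * (2 * Complex.I) =
      Complex.exp (Complex.I * θ m / 2) * Complex.exp (-(Complex.I * θ n / 2)) *
        (expPos θ n - expNeg θ m) := by
  have hpos : Complex.exp (Complex.I * θ m / 2) * Complex.exp (-(Complex.I * θ n / 2)) *
      expPos θ n = Complex.exp (((θ m + θ n) / 2 : ℂ) * Complex.I) := by
    rw [expPos, ← Complex.exp_add, ← Complex.exp_add]
    congr 1
    ring
  have hneg : Complex.exp (Complex.I * θ m / 2) * Complex.exp (-(Complex.I * θ n / 2)) *
      expNeg θ m = Complex.exp (-((θ m + θ n) / 2 : ℂ) * Complex.I) := by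
    rw [expNeg, ← Complex.exp_add, ← Complex.exp_add]
    congr 1
    ring
  rw [mul_sub, hpos, hneg, Complex.ofReal_sin, Complex.sin]
  push_cast
  linear_combination (Complex.exp (-((θ m + θ n) / 2 : ℂ) * Complex.I) -
    Complex.exp (((θ m + θ n) / 2 : ℂ) * Complex.I)) * Complex.I_mul_I

theorem cscMatrix_displacement (hθ : ∀ m n, Real.sin ((θ m + θ n) / 2) ≠ 0) (Y : Fin N → ℂ)
    (m n : Fin N) :
    (cscMatrix θ * diagonal Y) m n * (expPos θ n - expNeg θ m) =
      (Complex.exp (Complex.I * θ m / 2))⁻¹ *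
        (2 * Complex.I * (Complex.exp (-(Complex.I * θ n / 2)))⁻¹ * Y n) := by
  have hsin : (Real.sin ((θ m + θ n) / 2) : ℂ) ≠ 0 := by exact_mod_cast hθ m n
  have hm := Complex.exp_ne_zero (Complex.I * θ m / 2)
  have hn := Complex.exp_ne_zero (-(Complex.I * θ n / 2))
  rw [mul_diagonal, cscMatrix, of_apply]
  field_simp
  linear_combination -Y n * sin_half_add_mul θ m n

theorem solitonTau_fay (hθ : ∀ m n, Real.sin ((θ m + θ n) / 2) ≠ 0) (Y : Fin N → ℂ)
    {a b c d : ℂ × ℂ} (ha : ‖a.1‖ ≠ ‖a.2‖) (hb : ‖b.1‖ ≠ ‖b.2‖) (hc : ‖c.1‖ ≠ ‖c.2‖)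
    (hd : ‖d.1‖ ≠ ‖d.2‖) {Xab Xcd Xac Xbd Xad Xbc : Fin N → ℂ}
    (hX : ∀ n, Xab n = Y n * (pointWeight θ a n * pointWeight θ b n) ∧
      Xcd n = Y n * (pointWeight θ c n * pointWeight θ d n) ∧
      Xac n = Y n * (pointWeight θ a n * pointWeight θ c n) ∧
      Xbd n = Y n * (pointWeight θ b n * pointWeight θ d n) ∧
      Xad n = Y n * (pointWeight θ a n * pointWeight θ d n) ∧
      Xbc n = Y n * (pointWeight θ b n * pointWeight θ c n)) :
    bracket a b * bracket c d * (solitonTau θ Xab * solitonTau θ Xcd) -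
      bracket a c * bracket b d * (solitonTau θ Xac * solitonTau θ Xbd) +
      bracket a d * bracket b c * (solitonTau θ Xad * solitonTau θ Xbc) = 0 := by
  simp only [forall_and] at hX
  obtain ⟨hab, hcd, hac, hbd, had, hbc⟩ := hX
  have hfay := fay_identity (cscMatrix_displacement hθ Y) (isAdmissible_of_norm_ne θ ha)
    (isAdmissible_of_norm_ne θ hb) (isAdmissible_of_norm_ne θ hc) (isAdmissible_of_norm_ne θ hd)
  simp only [← solitonTau_mul] at hfay
  convert hfay <;> funext n
  exacts [hab n, hcd n, hac n, hbd n, had n, hbc n]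

end Tau

section Wave

/-- Admissible pairs of base points: the positive half of the hierarchy is attached to the pair
`(0, μ)`, the negative half to `(μ, 0)`. -/
structure IsBasePair (o o' : ℂ) : Prop where
  norm_left : ‖o‖ ≠ 1
  norm_right : ‖o'‖ ≠ 1
  sub_ne : o - o' ≠ 0
  mul_sub_ne : o * o' - 1 ≠ 0

/-- The points `a` for which the shift attached to `a` is regular. -/
structure IsShiftPoint (o o' a : ℂ) : Prop where
  norm_ne : ‖a‖ ≠ 1
  sub_ne : a - o' ≠ 0
  mul_left_ne : a * o - 1 ≠ 0
  mul_right_ne : a * o' - 1 ≠ 0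

/-- The parameter of the Miwa shift attached to the point `a`; in the paper's notation it is `ξ` as
a function of `α(ξ)`, respectively `η` as a function of `β(η)`. -/
def miwaParam {K : Type*} [Field K] (κ o o' a : K) : K :=
  κ * ((a - o) * (a * o - 1)) / ((a - o') * (a * o' - 1))

/-- The factor by which the shift attached to the point `a` multiplies the plane wave. -/
def multiplier {K : Type*} [Field K] (o o' a : K) : K :=
  (a - o') * (o ^ 2 - 1) / ((o - o') * (a * o - 1))

/-- The values at one point of the plane wave `e^{iφ}` and of the soliton exponentials. -/
@[ext]
structure WaveState (N : ℕ) where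
  plane : ℂ
  soliton : Fin N → ℂ

variable {N : ℕ} {θ : Fin N → ℝ}

/-- The shift attached to the point `a`, in the half of the hierarchy with base points `o`, `o'`. -/
noncomputable def WaveState.shift (θ : Fin N → ℝ) (o o' a : ℂ) (s : WaveState N) : WaveState N where
  plane := s.plane * multiplier o o' a
  soliton := s.soliton * weight θ a / weight θ o

/-- The function `U` of the hierarchy, for the base points `(0, μ)`, and the function `u`, for the
base points `(μ, 0)`. -/
noncomputable def field (θ : Fin N → ℝ) (o o' P : ℂ) (s : WaveState N) : ℂ :=
  P * s.plane * (solitonTau θ (s.soliton * weight θ o / crossWeight θ o o') /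
    solitonTau θ (s.soliton * weight θ o))

/-- The function `V` of the hierarchy, for the base points `(0, μ)`, and the function `v`, for the
base points `(μ, 0)`. -/
noncomputable def cofield (θ : Fin N → ℝ) (o o' Q : ℂ) (s : WaveState N) : ℂ :=
  Q * s.plane⁻¹ * (solitonTau θ (s.soliton * weight θ o' * crossWeight θ o o') /
    solitonTau θ (s.soliton * weight θ o'))

/-- The function `G` of the hierarchy, for the base points `(0, μ)`, and the function `g`, for the
base points `(μ, 0)`. -/
noncomputable def gain (θ : Fin N → ℝ) (κ o o' P Q a : ℂ) (s : WaveState N) : ℂ :=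
  1 + miwaParam κ o o' a * field θ o o' P (s.shift θ o o' a) * cofield θ o o' Q s

variable {κ o o' a a₁ a₂ P P' Q : ℂ} {s : WaveState N}

theorem IsBasePair.symm (h : IsBasePair o o') : IsBasePair o' o :=
  ⟨h.norm_right, h.norm_left, sub_ne_zero.2 (sub_ne_zero.1 h.sub_ne).symm,
    mul_comm o o' ▸ h.mul_sub_ne⟩

theorem IsBasePair.sq_sub_one_ne (h : IsBasePair o o') : o ^ 2 - 1 ≠ 0 := by
  intro ho
  have hnorm : ‖o‖ ^ 2 = 1 := by rw [← norm_pow, sub_eq_zero.1 ho, norm_one]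
  exact h.norm_left ((pow_eq_one_iff_of_nonneg (norm_nonneg o) two_ne_zero).1 hnorm)

theorem weights_ne_zero (hb : IsBasePair o o') (n : Fin N) :
    weight θ o n ≠ 0 ∧ weight θ o' n ≠ 0 ∧ crossWeight θ o o' n ≠ 0 :=
  ⟨weight_ne_zero θ hb.norm_left n, weight_ne_zero θ hb.norm_right n,
    crossWeight_ne_zero θ hb.norm_left hb.norm_right n⟩

theorem solitonTau_fay_gain (hθ : ∀ m n, Real.sin ((θ m + θ n) / 2) ≠ 0) (hb : IsBasePair o o')
    (ha : ‖a‖ ≠ 1) (X : Fin N → ℂ) :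
    (o * o' - 1) * (a * o - 1) * (solitonTau θ (X * weight θ o) *
        solitonTau θ (X * weight θ a * weight θ o' / weight θ o)) =
      (a * o' - 1) * (o ^ 2 - 1) * (solitonTau θ (X * weight θ a) *
        solitonTau θ (X * weight θ o')) -
      (a - o) * (o - o') * (solitonTau θ (X * weight θ a / crossWeight θ o o') *
        solitonTau θ (X * weight θ o' * crossWeight θ o o')) := by
  have h := solitonTau_fay hθ (X / dualWeight θ o') (a := (1, o')) (b := (o, 1)) (c := (a, 1))
    (d := (1, o)) (by simpa using hb.norm_right.symm) (by simpa using hb.norm_left)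
    (by simpa using ha) (by simpa using hb.norm_left.symm) (Xab := X * weight θ o)
    (Xcd := X * weight θ a * weight θ o' / weight θ o) (Xac := X * weight θ a)
    (Xbd := X * weight θ o') (Xad := X * weight θ o' * crossWeight θ o o')
    (Xbc := X * weight θ a / crossWeight θ o o') (fun n => by
      obtain ⟨ho, ho', hJ⟩ := weights_ne_zero hb n
      simp only [pointWeight_affine, pointWeight_dual, dualWeight_left θ hb.norm_left hb.norm_right,
        dualWeight_right θ hb.norm_left hb.norm_right, Pi.mul_apply, Pi.div_apply]
      refine ⟨?_, ?_, ?_, ?_, ?_, ?_⟩ <;> field_simp)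
  simp only [bracket] at h
  linear_combination -h

theorem solitonTau_fay_base (hθ : ∀ m n, Real.sin ((θ m + θ n) / 2) ≠ 0) (hb : IsBasePair o o')
    (ha₁ : ‖a₁‖ ≠ 1) (ha₂ : ‖a₂‖ ≠ 1) (X : Fin N → ℂ) :
    (a₁ - a₂) * (o - o') * (solitonTau θ (X * weight θ a₁ * weight θ a₂ / weight θ o) *
        solitonTau θ (X * weight θ o')) =
      (a₁ - o) * (a₂ - o') * (solitonTau θ (X * weight θ a₁) *
        solitonTau θ (X * weight θ a₂ * weight θ o' / weight θ o)) -
      (a₁ - o') * (a₂ - o) * (solitonTau θ (X * weight θ a₁ * weight θ o' / weight θ o) *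
        solitonTau θ (X * weight θ a₂)) := by
  have h := solitonTau_fay hθ (X / weight θ o) (a := (a₁, 1)) (b := (a₂, 1)) (c := (o', 1))
    (d := (o, 1)) (by simpa using ha₁) (by simpa using ha₂) (by simpa using hb.norm_right)
    (by simpa using hb.norm_left) (Xab := X * weight θ a₁ * weight θ a₂ / weight θ o)
    (Xcd := X * weight θ o') (Xac := X * weight θ a₁ * weight θ o' / weight θ o)
    (Xbd := X * weight θ a₂) (Xad := X * weight θ a₁)
    (Xbc := X * weight θ a₂ * weight θ o' / weight θ o) (fun n => by
      obtain ⟨ho, -, -⟩ := weights_ne_zero hb n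
      simp only [pointWeight_affine, Pi.mul_apply, Pi.div_apply]
      refine ⟨?_, ?_, ?_, ?_, ?_, ?_⟩ <;> field_simp)
  simp only [bracket] at h
  linear_combination -h

theorem solitonTau_fay_dual (hθ : ∀ m n, Real.sin ((θ m + θ n) / 2) ≠ 0) (hb : IsBasePair o o')
    (ha₁ : ‖a₁‖ ≠ 1) (ha₂ : ‖a₂‖ ≠ 1) (X : Fin N → ℂ) :
    (a₁ - a₂) * (o * o' - 1) *
        (solitonTau θ (X * weight θ a₁ * weight θ a₂ / weight θ o / crossWeight θ o o') *
          solitonTau θ (X * weight θ o)) =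
      (a₁ - o) * (a₂ * o' - 1) * (solitonTau θ (X * weight θ a₁ / crossWeight θ o o') *
        solitonTau θ (X * weight θ a₂)) -
      (a₁ * o' - 1) * (a₂ - o) * (solitonTau θ (X * weight θ a₁) *
        solitonTau θ (X * weight θ a₂ / crossWeight θ o o')) := by
  have h := solitonTau_fay hθ (X / dualWeight θ o') (a := (a₁, 1)) (b := (a₂, 1)) (c := (1, o'))
    (d := (o, 1)) (by simpa using ha₁) (by simpa using ha₂) (by simpa using hb.norm_right.symm)
    (by simpa using hb.norm_left)
    (Xab := X * weight θ a₁ * weight θ a₂ / weight θ o / crossWeight θ o o')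
    (Xcd := X * weight θ o) (Xac := X * weight θ a₁)
    (Xbd := X * weight θ a₂ / crossWeight θ o o') (Xad := X * weight θ a₁ / crossWeight θ o o')
    (Xbc := X * weight θ a₂) (fun n => by
      obtain ⟨ho, -, hJ⟩ := weights_ne_zero hb n
      simp only [pointWeight_affine, pointWeight_dual,
        dualWeight_right θ hb.norm_left hb.norm_right, Pi.mul_apply, Pi.div_apply]
      refine ⟨?_, ?_, ?_, ?_, ?_, ?_⟩ <;> field_simp)
  simp only [bracket] at h
  linear_combination -h

theorem solitonTau_fay_mixed (hθ : ∀ m n, Real.sin ((θ m + θ n) / 2) ≠ 0) (hb : IsBasePair o o')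
    (ha : ‖a‖ ≠ 1) (X : Fin N → ℂ) :
    (a - o') * (o * o' - 1) *
        (solitonTau θ (X * weight θ a * weight θ o' / weight θ o / crossWeight θ o o') *
          solitonTau θ (X * weight θ o)) =
      (o - o') * (a * o' - 1) * (solitonTau θ (X * weight θ o' / crossWeight θ o o') *
        solitonTau θ (X * weight θ a)) +
      (o' ^ 2 - 1) * (a - o) * (solitonTau θ (X * weight θ o') *
        solitonTau θ (X * weight θ a / crossWeight θ o o')) := by
  have h := solitonTau_fay hθ (X / dualWeight θ o') (a := (o', 1)) (b := (a, 1)) (c := (o, 1))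
    (d := (1, o')) (by simpa using hb.norm_right) (by simpa using ha)
    (by simpa using hb.norm_left) (by simpa using hb.norm_right.symm)
    (Xab := X * weight θ a * weight θ o' / weight θ o / crossWeight θ o o')
    (Xcd := X * weight θ o) (Xac := X * weight θ o' / crossWeight θ o o')
    (Xbd := X * weight θ a) (Xad := X * weight θ o')
    (Xbc := X * weight θ a / crossWeight θ o o') (fun n => by
      obtain ⟨ho, -, hJ⟩ := weights_ne_zero hb n
      simp only [pointWeight_affine, pointWeight_dual,
        dualWeight_right θ hb.norm_left hb.norm_right, Pi.mul_apply, Pi.div_apply]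
      refine ⟨?_, ?_, ?_, ?_, ?_, ?_⟩ <;> field_simp)
  simp only [bracket] at h
  linear_combination -h

/-- Both denominators of `field` and `cofield` are nonzero at the state `s`. -/
def WaveState.IsRegular (θ : Fin N → ℝ) (o o' : ℂ) (s : WaveState N) : Prop :=
  solitonTau θ (s.soliton * weight θ o) ≠ 0 ∧ solitonTau θ (s.soliton * weight θ o') ≠ 0

theorem soliton_shift_mul_weight_left (hb : IsBasePair o o') (s : WaveState N) :
    (s.shift θ o o' a).soliton * weight θ o = s.soliton * weight θ a := by
  funext n
  have ho := weight_ne_zero θ hb.norm_left n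
  simp only [WaveState.shift, Pi.mul_apply, Pi.div_apply]
  field_simp

theorem soliton_shift_mul_weight (s : WaveState N) :
    (s.shift θ o o' a₁).soliton * weight θ a₂ =
      s.soliton * weight θ a₁ * weight θ a₂ / weight θ o := by
  simp only [WaveState.shift, div_mul_eq_mul_div]

theorem field_shift (hb : IsBasePair o o') (P : ℂ) (s : WaveState N) :
    field θ o o' P (s.shift θ o o' a) = P * (s.plane * multiplier o o' a) *
      (solitonTau θ (s.soliton * weight θ a / crossWeight θ o o') /
        solitonTau θ (s.soliton * weight θ a)) := by
  rw [field, soliton_shift_mul_weight_left hb]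
  rfl

theorem gain_eq (hθ : ∀ m n, Real.sin ((θ m + θ n) / 2) ≠ 0) (hb : IsBasePair o o')
    (ha : IsShiftPoint o o' a) (hPQ : κ * (P * Q) * (o ^ 2 - 1) ^ 2 = -(o - o') ^ 2)
    (hs₀ : s.plane ≠ 0) (hs : s.IsRegular θ o o')
    (hsa : solitonTau θ (s.soliton * weight θ a) ≠ 0) :
    gain θ κ o o' P Q a s = (o * o' - 1) * (a * o - 1) / ((a * o' - 1) * (o ^ 2 - 1)) *
      (solitonTau θ (s.soliton * weight θ o) *
        solitonTau θ (s.soliton * weight θ a * weight θ o' / weight θ o) /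
          (solitonTau θ (s.soliton * weight θ a) * solitonTau θ (s.soliton * weight θ o'))) := by
  have hfay := solitonTau_fay_gain hθ hb ha.norm_ne s.soliton
  have h₁ := hb.sq_sub_one_ne
  have h₂ := hb.sub_ne
  have h₃ := ha.sub_ne
  have h₄ := ha.mul_left_ne
  have h₅ := ha.mul_right_ne
  have h₆ := hs.2
  rw [gain, field_shift hb, cofield, miwaParam, multiplier]
  field_simp
  linear_combination -(o - o') * hfay + (a - o) *
    solitonTau θ (s.soliton * weight θ a / crossWeight θ o o') *
    solitonTau θ (s.soliton * weight θ o' * crossWeight θ o o') * hPQ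

theorem field_shift_shift (hb : IsBasePair o o') (P : ℂ) (s : WaveState N) :
    field θ o o' P ((s.shift θ o o' a₂).shift θ o o' a₁) =
      P * (s.plane * multiplier o o' a₂ * multiplier o o' a₁) *
        (solitonTau θ (s.soliton * weight θ a₁ * weight θ a₂ / weight θ o / crossWeight θ o o') /
          solitonTau θ (s.soliton * weight θ a₁ * weight θ a₂ / weight θ o)) := by
  rw [field_shift hb, soliton_shift_mul_weight, mul_right_comm s.soliton]
  rfl

theorem miwaParam_mul_gain_sub (hθ : ∀ m n, Real.sin ((θ m + θ n) / 2) ≠ 0)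
    (hb : IsBasePair o o') (ha₁ : IsShiftPoint o o' a₁) (ha₂ : IsShiftPoint o o' a₂)
    (hPQ : κ * (P * Q) * (o ^ 2 - 1) ^ 2 = -(o - o') ^ 2) (hs₀ : s.plane ≠ 0)
    (hs : s.IsRegular θ o o') (hs₁ : solitonTau θ (s.soliton * weight θ a₁) ≠ 0)
    (hs₂ : solitonTau θ (s.soliton * weight θ a₂) ≠ 0) :
    miwaParam κ o o' a₁ * gain θ κ o o' P Q a₂ s - miwaParam κ o o' a₂ * gain θ κ o o' P Q a₁ s =
      κ * (o * o' - 1) * (o - o') * ((a₁ * o - 1) * (a₂ * o - 1)) * (a₁ - a₂) /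
          ((o ^ 2 - 1) * ((a₁ * o' - 1) * (a₂ * o' - 1)) * ((a₁ - o') * (a₂ - o'))) *
        (solitonTau θ (s.soliton * weight θ o) *
          solitonTau θ (s.soliton * weight θ a₁ * weight θ a₂ / weight θ o) /
            (solitonTau θ (s.soliton * weight θ a₁) * solitonTau θ (s.soliton * weight θ a₂))) := by
  have hfay := solitonTau_fay_base hθ hb ha₁.norm_ne ha₂.norm_ne s.soliton
  have hsq := hb.sq_sub_one_ne
  have h₁ := ha₁.sub_ne
  have h₂ := ha₂.sub_ne
  have h₁' := ha₁.mul_right_ne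
  have h₂' := mul_comm a₂ o' ▸ ha₂.mul_right_ne
  have hs' := hs.2
  rw [gain_eq hθ hb ha₁ hPQ hs₀ hs hs₁, gain_eq hθ hb ha₂ hPQ hs₀ hs hs₂, miwaParam, miwaParam]
  field_simp
  linear_combination -κ * (o * o' - 1) * (a₁ * o - 1) * (a₂ * o - 1) *
    solitonTau θ (s.soliton * weight θ o) * hfay

theorem gain_field_shift_shift (hθ : ∀ m n, Real.sin ((θ m + θ n) / 2) ≠ 0)
    (hb : IsBasePair o o') (ha₁ : IsShiftPoint o o' a₁) (ha₂ : IsShiftPoint o o' a₂)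
    (hPQ : κ * (P * Q) * (o ^ 2 - 1) ^ 2 = -(o - o') ^ 2) (hs₀ : s.plane ≠ 0)
    (hs : s.IsRegular θ o o') (hs₁ : (s.shift θ o o' a₁).IsRegular θ o o')
    (hs₂ : (s.shift θ o o' a₂).IsRegular θ o o')
    (hs₁₂ : ((s.shift θ o o' a₂).shift θ o o' a₁).IsRegular θ o o') :
    (miwaParam κ o o' a₁ * gain θ κ o o' P Q a₂ s -
        miwaParam κ o o' a₂ * gain θ κ o o' P Q a₁ s) *
          field θ o o' P ((s.shift θ o o' a₂).shift θ o o' a₁) -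
      miwaParam κ o o' a₁ * field θ o o' P (s.shift θ o o' a₁) +
      miwaParam κ o o' a₂ * field θ o o' P (s.shift θ o o' a₂) = 0 := by
  have hτ₁ : solitonTau θ (s.soliton * weight θ a₁) ≠ 0 :=
    soliton_shift_mul_weight_left hb s ▸ hs₁.1
  have hτ₂ : solitonTau θ (s.soliton * weight θ a₂) ≠ 0 :=
    soliton_shift_mul_weight_left hb s ▸ hs₂.1
  have hτ₁₂ : solitonTau θ (s.soliton * weight θ a₁ * weight θ a₂ / weight θ o) ≠ 0 := by
    rw [mul_right_comm, ← soliton_shift_mul_weight, ← soliton_shift_mul_weight_left hb]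
    exact hs₁₂.1
  have hfay := solitonTau_fay_dual hθ hb ha₁.norm_ne ha₂.norm_ne s.soliton
  have hsub := hb.sub_ne
  have h₁ := ha₁.sub_ne
  have h₂ := ha₂.sub_ne
  have h₁' := mul_comm a₁ o' ▸ ha₁.mul_right_ne
  have h₂' := mul_comm a₂ o' ▸ ha₂.mul_right_ne
  have h₁'' := mul_comm a₁ o ▸ ha₁.mul_left_ne
  have h₂'' := mul_comm a₂ o ▸ ha₂.mul_left_ne
  rw [miwaParam_mul_gain_sub hθ hb ha₁ ha₂ hPQ hs₀ hs hτ₁ hτ₂, field_shift_shift hb,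
    field_shift hb, field_shift hb]
  simp only [miwaParam, multiplier]
  field_simp
  linear_combination κ * (o ^ 2 - 1) * P * s.plane * hfay

theorem gain_field_shift (hθ : ∀ m n, Real.sin ((θ m + θ n) / 2) ≠ 0)
    (hb : IsBasePair o o') (ha : IsShiftPoint o o' a)
    (hPQ : κ * (P * Q) * (o ^ 2 - 1) ^ 2 = -(o - o') ^ 2)
    (hPP' : κ * P * (o ^ 2 - 1) = P' * (o' ^ 2 - 1)) (hs₀ : s.plane ≠ 0)
    (hs : s.IsRegular θ o o') (hsa : (s.shift θ o o' a).IsRegular θ o o') :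
    gain θ κ o o' P Q a s * field θ o' o P' (s.shift θ o o' a) - field θ o' o P' s =
      miwaParam κ o o' a * field θ o o' P (s.shift θ o o' a) := by
  have hτ : solitonTau θ (s.soliton * weight θ a) ≠ 0 :=
    soliton_shift_mul_weight_left hb s ▸ hsa.1
  have hτ' : solitonTau θ (s.soliton * weight θ a * weight θ o' / weight θ o) ≠ 0 :=
    soliton_shift_mul_weight s ▸ hsa.2
  have hfay := solitonTau_fay_mixed hθ hb ha.norm_ne s.soliton
  have hsq := hb.sq_sub_one_ne
  have hsub := hb.sub_ne
  have h₁ := ha.sub_ne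
  have h₂ := mul_comm a o ▸ ha.mul_left_ne
  have h₃ := mul_comm a o' ▸ ha.mul_right_ne
  have hs' := hs.2
  rw [gain_eq hθ hb ha hPQ hs₀ hs hτ, field_shift hb, field, field,
    soliton_shift_mul_weight, crossWeight_comm θ o' o, miwaParam]
  simp only [WaveState.shift, multiplier]
  field_simp
  linear_combination P' * hfay - (a - o) * solitonTau θ (s.soliton * weight θ o') *
    solitonTau θ (s.soliton * weight θ a / crossWeight θ o o') * hPP'

end Wave

section Reflection

theorem Times.conj_conj (p : Times) : p.conj.conj = p := by
  simp [Times.conj]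

/-- The properties common to the positive and the negative Miwa shifts on which the symmetry between
the equations for `U`, `u` and those for `V = U*`, `v = u*` rests. -/
structure IsMiwaShift (T : ℂ → Times → Times) : Prop where
  comm : ∀ ξ η p, T ξ (T η p) = T η (T ξ p)
  conj_shift : ∀ ξ p, T (conj ξ) (T ξ p).conj = p.conj

theorem isMiwaShift_shiftPos : IsMiwaShift shiftPos where
  comm ξ η p := by
    simp only [shiftPos, add_right_comm]
  conj_shift ξ p := by
    simp only [shiftPos, Times.conj, map_add, map_mul, map_div₀, map_pow, Complex.conj_I,
      map_natCast, map_one, Times.mk.injEq, and_true]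
    ring_nf

theorem isMiwaShift_shiftNeg : IsMiwaShift shiftNeg where
  comm ξ η p := by
    simp only [shiftNeg, add_right_comm]
  conj_shift ξ p := by
    simp only [shiftNeg, Times.conj, map_add, map_mul, map_div₀, map_pow, Complex.conj_I,
      map_natCast, map_one, Times.mk.injEq, true_and]
    ring_nf

/-- The functions `G` and `g` of the hierarchy, for an arbitrary family `T` of shifts. -/
def shiftGain (T : ℂ → Times → Times) (U V : Times → ℂ) (ξ : ℂ) (p : Times) : ℂ :=
  1 + ξ * U (T ξ p) * V p

/-- The first equation of the positive and of the negative subhierarchy. -/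
def SolvesPure (T : ℂ → Times → Times) (D : Set Times) (r : ℝ) (U V : Times → ℂ) : Prop :=
  ∀ ξ₁ ξ₂ : ℂ, ‖ξ₁‖ < r → ‖ξ₂‖ < r → ∀ p ∈ D, T ξ₁ p ∈ D → T ξ₂ p ∈ D → T ξ₁ (T ξ₂ p) ∈ D →
    (ξ₁ * shiftGain T U V ξ₂ p - ξ₂ * shiftGain T U V ξ₁ p) * U (T ξ₁ (T ξ₂ p)) - ξ₁ * U (T ξ₁ p) +
      ξ₂ * U (T ξ₂ p) = 0

/-- The mixed equation by which the shifts `T` of the half `U`, `V` of the hierarchy act on the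
function `W` of the other half. -/
def SolvesMixed (T : ℂ → Times → Times) (D : Set Times) (r : ℝ) (U V W : Times → ℂ) : Prop :=
  ∀ ξ : ℂ, ‖ξ‖ < r → ∀ p ∈ D, T ξ p ∈ D →
    shiftGain T U V ξ p * W (T ξ p) - W p = ξ * U (T ξ p)

variable {T : ℂ → Times → Times} {D : Set Times} {r : ℝ} {U W u : Times → ℂ}

theorem SolvesPure.coequation (hT : IsMiwaShift T) (hD : ∀ p ∈ D, p.conj ∈ D)
    (h : SolvesPure T D r U (reflect U)) {ξ₁ ξ₂ : ℂ} (hξ₁ : ‖ξ₁‖ < r) (hξ₂ : ‖ξ₂‖ < r) {p : Times}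
    (hp : p ∈ D) (hp₁ : T ξ₁ p ∈ D) (hp₂ : T ξ₂ p ∈ D) (hp₁₂ : T ξ₁ (T ξ₂ p) ∈ D) :
    (ξ₁ * shiftGain T U (reflect U) ξ₂ (T ξ₁ p) -
        ξ₂ * shiftGain T U (reflect U) ξ₁ (T ξ₂ p)) * reflect U p -
      ξ₁ * reflect U (T ξ₂ p) + ξ₂ * reflect U (T ξ₁ p) = 0 := by
  set q := (T ξ₁ (T ξ₂ p)).conj with hq
  have hq₁ : T (conj ξ₁) q = (T ξ₂ p).conj := hT.conj_shift ξ₁ (T ξ₂ p)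
  have hq₂ : T (conj ξ₂) q = (T ξ₁ p).conj := by
    rw [hq, hT.comm, hT.conj_shift]
  have hq₁₂ : T (conj ξ₁) (T (conj ξ₂) q) = p.conj := by
    rw [hq₂, hT.conj_shift]
  have heq := h (conj ξ₁) (conj ξ₂) (by rwa [RCLike.norm_conj]) (by rwa [RCLike.norm_conj]) q
    (hD _ hp₁₂) (hq₁ ▸ hD _ hp₂) (hq₂ ▸ hD _ hp₁) (hq₁₂ ▸ hD _ hp)
  have hconj := congrArg conj heq
  simp only [shiftGain, reflect, hq₁, hq₂, hT.conj_shift] at hconj ⊢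
  rw [hT.comm ξ₂ ξ₁]
  simp only [map_add, map_sub, map_mul, map_one, map_zero, Complex.conj_conj] at hconj
  rw [hq, Times.conj_conj] at hconj
  linear_combination hconj

theorem SolvesMixed.coequation (hT : IsMiwaShift T) (hD : ∀ p ∈ D, p.conj ∈ D)
    (h : SolvesMixed T D r U (reflect U) W) {ξ : ℂ} (hξ : ‖ξ‖ < r) {p : Times} (hp : p ∈ D)
    (hp' : T ξ p ∈ D) :
    shiftGain T U (reflect U) ξ p * reflect W p - reflect W (T ξ p) =
      ξ * reflect U p := by
  have hq : T (conj ξ) (T ξ p).conj = p.conj := hT.conj_shift ξ p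
  have heq := h (conj ξ) (by rwa [RCLike.norm_conj]) _ (hD _ hp') (hq ▸ hD _ hp)
  have hconj := congrArg conj heq
  simp only [shiftGain, reflect, hq, Times.conj_conj, map_add, map_sub, map_mul, map_one,
    Complex.conj_conj] at hconj ⊢
  linear_combination hconj

theorem IsExtendedDNLSH.of_reflect (hD : ∀ p ∈ D, p.conj ∈ D)
    (hpos : SolvesPure shiftPos D r U (reflect U)) (hneg : SolvesPure shiftNeg D r u (reflect u))
    (hmixedU : SolvesMixed shiftNeg D r u (reflect u) U)
    (hmixedu : SolvesMixed shiftPos D r U (reflect U) u) :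
    IsExtendedDNLSH D r U (reflect U) u (reflect u) where
  pos_U := hpos
  pos_V _ _ h₁ h₂ _ hp hp₁ hp₂ hp₁₂ := hpos.coequation isMiwaShift_shiftPos hD h₁ h₂ hp hp₁ hp₂ hp₁₂
  neg_u := hneg
  neg_v _ _ h₁ h₂ _ hp hp₁ hp₂ hp₁₂ := hneg.coequation isMiwaShift_shiftNeg hD h₁ h₂ hp hp₁ hp₂ hp₁₂
  mixed_U := hmixedU
  mixed_V _ hη _ hp hp' := hmixedU.coequation isMiwaShift_shiftNeg hD hη hp hp'
  mixed_u := hmixedu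
  mixed_v _ hξ _ hp hp' := hmixedu.coequation isMiwaShift_shiftPos hD hξ hp hp'

end Reflection

section Realization

variable {N : ℕ} {θ : Fin N → ℝ} {T : ℂ → Times → Times} {S : Times → WaveState N}
  {D : Set Times} {r : ℝ} {κ o o' P P' Q : ℂ}

/-- On the times in `D`, the shift `T ξ` acts on the wave states `S` as the shift attached to some
regular point with parameter `ξ`. -/
def RealizesShift (θ : Fin N → ℝ) (κ o o' : ℂ) (T : ℂ → Times → Times) (D : Set Times)
    (S : Times → WaveState N) (ξ : ℂ) : Prop :=
  ∃ a, IsShiftPoint o o' a ∧ miwaParam κ o o' a = ξ ∧ ∀ p ∈ D, S (T ξ p) = (S p).shift θ o o' a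

theorem solvesPure_field (hθ : ∀ m n, Real.sin ((θ m + θ n) / 2) ≠ 0) (hb : IsBasePair o o')
    (hPQ : κ * (P * Q) * (o ^ 2 - 1) ^ 2 = -(o - o') ^ 2)
    (hT : ∀ ξ, ‖ξ‖ < r → RealizesShift θ κ o o' T D S ξ)
    (hS : ∀ p ∈ D, (S p).plane ≠ 0 ∧ (S p).IsRegular θ o o') :
    SolvesPure T D r (fun p => field θ o o' P (S p)) (fun p => cofield θ o o' Q (S p)) := by
  intro ξ₁ ξ₂ hξ₁ hξ₂ p hp hp₁ hp₂ hp₁₂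
  obtain ⟨a₁, ha₁, rfl, hS₁⟩ := hT ξ₁ hξ₁
  obtain ⟨a₂, ha₂, rfl, hS₂⟩ := hT ξ₂ hξ₂
  have h₁ := (hS _ hp₁).2
  have h₂ := (hS _ hp₂).2
  have h₁₂ := (hS _ hp₁₂).2
  rw [hS₁ p hp] at h₁
  rw [hS₂ p hp] at h₂
  rw [hS₁ _ hp₂, hS₂ p hp] at h₁₂
  simp only [shiftGain, hS₁ p hp, hS₁ _ hp₂, hS₂ p hp]
  exact gain_field_shift_shift hθ hb ha₁ ha₂ hPQ (hS p hp).1 (hS p hp).2 h₁ h₂ h₁₂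

theorem solvesMixed_field (hθ : ∀ m n, Real.sin ((θ m + θ n) / 2) ≠ 0) (hb : IsBasePair o o')
    (hPQ : κ * (P * Q) * (o ^ 2 - 1) ^ 2 = -(o - o') ^ 2)
    (hPP' : κ * P * (o ^ 2 - 1) = P' * (o' ^ 2 - 1))
    (hT : ∀ ξ, ‖ξ‖ < r → RealizesShift θ κ o o' T D S ξ)
    (hS : ∀ p ∈ D, (S p).plane ≠ 0 ∧ (S p).IsRegular θ o o') :
    SolvesMixed T D r (fun p => field θ o o' P (S p)) (fun p => cofield θ o o' Q (S p))
      (fun p => field θ o' o P' (S p)) := by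
  intro ξ hξ p hp hp'
  obtain ⟨a, ha, rfl, hSa⟩ := hT ξ hξ
  have hreg := (hS _ hp').2
  rw [hSa p hp] at hreg
  simp only [shiftGain, hSa p hp]
  exact gain_field_shift hθ hb ha hPQ hPP' (hS p hp).1 (hS p hp).2 hreg

variable {s s' : WaveState N}

theorem conj_weight (θ : Fin N → ℝ) (a : ℂ) (n : Fin N) :
    conj (weight θ a n) = (weight θ (conj a) n)⁻¹ := by
  simp only [weight_apply, map_div₀, map_sub, map_one, map_mul, conj_expPos, conj_expNeg, inv_div]

theorem conj_crossWeight (ho : conj o = o) (ho' : conj o' = o') (n : Fin N) :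
    conj (crossWeight θ o o' n) = (crossWeight θ o o' n)⁻¹ := by
  have hdual : conj (dualWeight θ 0 n) = (dualWeight θ 0 n)⁻¹ := by
    simp [dualWeight, pointWeight, shiftWeight, lin, conj_expPos, conj_expNeg]
  rw [crossWeight, Pi.div_apply, Pi.mul_apply, map_div₀, map_mul, conj_weight, conj_weight, ho, ho',
    hdual]
  simp only [div_eq_mul_inv, mul_inv]

theorem conj_solitonTau (θ : Fin N → ℝ) (X : Fin N → ℂ) :
    conj (solitonTau θ X) = solitonTau θ (fun n => conj (X n)) := by
  rw [solitonTau, tauDet, RingHom.map_det]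
  congr 1
  ext m n
  simp [cscMatrix, Matrix.one_apply, apply_ite conj, -Complex.ofReal_sin]

/-- `s'` is the state at the complex conjugate times of `s`. -/
structure WaveState.IsReflection (θ : Fin N → ℝ) (o o' : ℂ) (s s' : WaveState N) : Prop where
  plane : conj s'.plane = s.plane⁻¹
  soliton : ∀ n, conj (s'.soliton n) = s.soliton n * (weight θ o n * weight θ o' n)

theorem conj_solitonTau_mul_weight (hb : IsBasePair o o') (ho : conj o = o)
    (h : s.IsReflection θ o o' s') :
    conj (solitonTau θ (s'.soliton * weight θ o)) = solitonTau θ (s.soliton * weight θ o') := by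
  rw [conj_solitonTau]
  congr 1
  funext n
  have hw := weight_ne_zero θ hb.norm_left n
  simp only [Pi.mul_apply, map_mul, conj_weight, h.soliton, ho]
  field_simp

theorem conj_field (hb : IsBasePair o o') (ho : conj o = o) (ho' : conj o' = o') (P : ℂ)
    (h : s.IsReflection θ o o' s') :
    conj (field θ o o' P s') = cofield θ o o' (conj P) s := by
  have hJ : conj (solitonTau θ (s'.soliton * weight θ o / crossWeight θ o o')) =
      solitonTau θ (s.soliton * weight θ o' * crossWeight θ o o') := by
    rw [conj_solitonTau]
    congr 1
    funext n
    have hw := weight_ne_zero θ hb.norm_left n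
    simp only [Pi.mul_apply, Pi.div_apply, map_mul, map_div₀, conj_weight, h.soliton, ho,
      conj_crossWeight ho ho', div_inv_eq_mul]
    field_simp
  rw [field, cofield, map_mul, map_mul, map_div₀, h.plane, hJ, conj_solitonTau_mul_weight hb ho h]

end Realization

section PowerSeries

/-- Near `0`, the function `f` is the sum of the generating series with coefficients `e`; this is
how the paper prescribes the coefficients of the phases. -/
def IsGeneratedBy (e : ℕ → ℝ) (f : ℝ → ℝ) : Prop :=
  ∀ᶠ x in 𝓝 (0 : ℝ), HasSum (fun k : ℕ => e k * x ^ (k + 1) / ((k : ℝ) + 1)) (f x)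

/-- A Miwa shift by `z` changes the phase with coefficients `e` by an amount whose exponential,
scaled by `l`, is `G z`. -/
def HasShiftFactor (e : ℕ → ℝ) (l : ℂ) (G : ℂ → ℂ) : Prop :=
  ∀ᶠ z in 𝓝 (0 : ℂ), ∃ S, HasSum (fun k : ℕ => (e k : ℂ) *
    (Complex.I * z ^ (k + 1) / ((k : ℂ) + 1))) S ∧ Complex.exp (l * S) = G z

variable {e : ℕ → ℝ} {f g : ℝ → ℝ} {F G : ℂ → ℂ} {l : ℂ}

theorem IsGeneratedBy.congr (h : IsGeneratedBy e f) (hfg : f =ᶠ[𝓝 0] g) : IsGeneratedBy e g := by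
  filter_upwards [h, hfg] with x hx hfgx
  rwa [← hfgx]

theorem isGeneratedBy_congr (hfg : f =ᶠ[𝓝 0] g) : IsGeneratedBy e f ↔ IsGeneratedBy e g :=
  ⟨fun h => h.congr hfg, fun h => h.congr hfg.symm⟩

theorem tendsto_ofReal_nhds_zero : Tendsto (fun x : ℝ => (x : ℂ)) (𝓝 0) (𝓝 0) :=
  Complex.continuous_ofReal.tendsto' 0 0 Complex.ofReal_zero

/-- The complexified generating series. Its constant coefficient is the junk value
`e 0 / 0 = 0`. -/
noncomputable def generatingSeries (e : ℕ → ℝ) : FormalMultilinearSeries ℂ ℂ ℂ :=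
  FormalMultilinearSeries.ofScalars ℂ fun n => (e (n - 1) : ℂ) / n

theorem generatingSeries_apply (e : ℕ → ℝ) (k : ℕ) (z : ℂ) :
    (generatingSeries e (k + 1) fun _ => z) = (e k : ℂ) * (z ^ (k + 1) / ((k : ℂ) + 1)) := by
  simp [generatingSeries, FormalMultilinearSeries.ofScalars]
  ring

theorem IsGeneratedBy.radius_pos (h : IsGeneratedBy e f) : 0 < (generatingSeries e).radius := by
  obtain ⟨x, hx, hx₀⟩ := (h.filter_mono nhdsWithin_le_nhds).and
    (self_mem_nhdsWithin (a := (0 : ℝ)) (s := {0}ᶜ)) |>.exists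
  refine lt_of_lt_of_le ?_ ((generatingSeries e).le_radius_of_tendsto (r := ‖x‖₊) (l := 0) ?_)
  · simpa using hx₀
  · rw [← tendsto_add_atTop_iff_nat 1]
    refine (tendsto_zero_iff_norm_tendsto_zero.1 hx.summable.tendsto_atTop_zero).congr fun k => ?_
    have hk : ‖(k : ℂ) + 1‖ = |(k : ℝ) + 1| := by
      simpa using Complex.norm_real ((k : ℝ) + 1)
    simp only [generatingSeries, FormalMultilinearSeries.ofScalars_norm, Nat.add_sub_cancel,
      Nat.cast_add_one, norm_div, norm_mul, norm_pow, Complex.norm_real, Real.norm_eq_abs, hk,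
      coe_nnnorm]
    ring

theorem IsGeneratedBy.exists_analytic_extension (h : IsGeneratedBy e f) :
    ∃ H : ℂ → ℂ, AnalyticAt ℂ H 0 ∧ H 0 = 0 ∧ HasDerivAt H (e 0) 0 ∧
      (∀ᶠ z in 𝓝 (0 : ℂ),
        HasSum (fun k : ℕ => (e k : ℂ) * (z ^ (k + 1) / ((k : ℂ) + 1))) (H z)) ∧
      ∀ᶠ x : ℝ in 𝓝 0, H x = f x := by
  have hP := ((generatingSeries e).hasFPowerSeriesOnBall h.radius_pos).hasFPowerSeriesAt
  have hP₀ (v : Fin 0 → ℂ) : generatingSeries e 0 v = 0 := by simp [generatingSeries]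
  have hsum : ∀ᶠ z in 𝓝 (0 : ℂ), HasSum (fun k : ℕ => (e k : ℂ) * (z ^ (k + 1) / ((k : ℂ) + 1)))
      ((generatingSeries e).sum z) := by
    filter_upwards [hP.eventually_hasSum] with z hz
    rw [zero_add, ← hasSum_nat_add_iff' 1] at hz
    simpa only [Finset.range_one, Finset.sum_singleton, hP₀, sub_zero, generatingSeries_apply]
      using hz
  have hderiv : HasDerivAt (generatingSeries e).sum (e 0) 0 := by
    simpa [generatingSeries] using hP.hasDerivAt
  refine ⟨_, hP.analyticAt, (hP.coeff_zero fun _ => 0).symm.trans (hP₀ _), hderiv, hsum, ?_⟩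
  filter_upwards [tendsto_ofReal_nhds_zero.eventually hsum, h] with x hx hfx
  refine hx.unique ((Complex.hasSum_ofReal.2 hfx).congr_fun fun k => ?_)
  push_cast
  ring

theorem eventually_eq_of_eventually_eq_ofReal (hF : AnalyticAt ℂ F 0) (hG : AnalyticAt ℂ G 0)
    (h : ∀ᶠ x : ℝ in 𝓝 0, F x = G x) : F =ᶠ[𝓝 0] G := by
  refine (hF.frequently_eq_iff_eventually_eq hG).1 ?_
  have hreal : Tendsto (fun x : ℝ => (x : ℂ)) (𝓝[≠] 0) (𝓝[≠] 0) :=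
    tendsto_ofReal_nhds_zero.inf (tendsto_principal_principal.2 fun x hx => by simpa using hx)
  exact hreal.frequently (h.filter_mono nhdsWithin_le_nhds).frequently

theorem IsGeneratedBy.hasShiftFactor (h : IsGeneratedBy e f) (hG : AnalyticAt ℂ G 0)
    (hfG : ∀ᶠ x : ℝ in 𝓝 0, Complex.exp (l * Complex.I * f x) = G x) :
    HasShiftFactor e l G ∧ HasDerivAt G (l * Complex.I * e 0) 0 := by
  obtain ⟨H, hH, hH₀, hH', hsum, hHf⟩ := h.exists_analytic_extension
  have hexp : (fun z => Complex.exp (l * Complex.I * H z)) =ᶠ[𝓝 0] G := by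
    refine eventually_eq_of_eventually_eq_ofReal (by fun_prop) hG ?_
    filter_upwards [hHf, hfG] with x hx hfx
    rw [hx, hfx]
  constructor
  · filter_upwards [hexp, hsum] with z hz hsumz
    refine ⟨Complex.I * H z, ?_, by rw [← mul_assoc, hz]⟩
    exact (hsumz.mul_left Complex.I).congr_fun fun k => by ring
  · have hderiv := (hH'.const_mul (l * Complex.I)).cexp
    rw [hH₀, mul_zero, Complex.exp_zero, one_mul] at hderiv
    exact hderiv.congr_of_eventuallyEq hexp.symm

theorem exists_isGeneratedBy_re (hF : AnalyticAt ℂ F 0) (hF₀ : F 0 = 0) :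
    ∃ e : ℕ → ℝ, IsGeneratedBy e fun x => (F x).re := by
  obtain ⟨P, hP⟩ := hF
  refine ⟨fun k => (P.coeff (k + 1)).re * ((k : ℝ) + 1), ?_⟩
  filter_upwards [tendsto_ofReal_nhds_zero.eventually hP.eventually_hasSum] with x hx
  rw [zero_add, ← hasSum_nat_add_iff' 1, Finset.range_one, Finset.sum_singleton, hP.coeff_zero,
    hF₀, sub_zero] at hx
  refine (Complex.hasSum_re hx).congr_fun fun k => ?_
  have hk : ((k : ℝ) + 1) ≠ 0 := by positivity
  rw [FormalMultilinearSeries.apply_eq_pow_smul_coeff, smul_eq_mul, ← Complex.ofReal_pow,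
    Complex.re_ofReal_mul]
  field_simp

end PowerSeries

section HalfDispersion

variable {N : ℕ} {κ o o' : ℂ}

theorem analyticAt_miwaParam (κ : ℂ) (hb : IsBasePair o o') :
    AnalyticAt ℂ (miwaParam κ o o') o := by
  have hden : (o - o') * (o * o' - 1) ≠ 0 := mul_ne_zero hb.sub_ne hb.mul_sub_ne
  unfold miwaParam
  fun_prop (disch := assumption)

theorem deriv_miwaParam_ne_zero (hκ : κ ≠ 0) (hb : IsBasePair o o') :
    deriv (miwaParam κ o o') o ≠ 0 := by
  have h₁ := hb.sub_ne
  have h₂ := hb.mul_sub_ne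
  have hlin : HasDerivAt (fun a : ℂ => a - o) 1 o := (hasDerivAt_id o).sub_const o
  have hcof : AnalyticAt ℂ (fun a => κ * (a * o - 1) / ((a - o') * (a * o' - 1))) o := by
    have hden : (o - o') * (o * o' - 1) ≠ 0 := mul_ne_zero h₁ h₂
    fun_prop (disch := assumption)
  have hprod := hlin.mul hcof.differentiableAt.hasDerivAt
  rw [sub_self, zero_mul, add_zero, one_mul] at hprod
  have heq : miwaParam κ o o' =
      (fun a => a - o) * fun a => κ * (a * o - 1) / ((a - o') * (a * o' - 1)) := by
    funext a
    simp only [miwaParam, Pi.mul_apply]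
    ring
  rw [heq, hprod.deriv, ← sq]
  exact div_ne_zero (mul_ne_zero hκ hb.sq_sub_one_ne) (mul_ne_zero h₁ h₂)

theorem exists_branch (hκ : κ ≠ 0) (hb : IsBasePair o o') :
    ∃ A : ℂ → ℂ, AnalyticAt ℂ A 0 ∧ A 0 = o ∧ deriv A 0 ≠ 0 ∧
      (∀ᶠ z in 𝓝 0, miwaParam κ o o' (A z) = z) ∧ ∀ᶠ a in 𝓝 o, A (miwaParam κ o o' a) = a := by
  have hF := analyticAt_miwaParam κ hb
  have hF' := deriv_miwaParam_ne_zero hκ hb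
  have hF₀ : miwaParam κ o o' o = 0 := by simp [miwaParam]
  have hA := hF.analyticAt_localInverse hF'
  have hleft := hF.hasStrictDerivAt.eventually_left_inverse hF'
  have hright := hF.hasStrictDerivAt.eventually_right_inverse hF'
  have hderiv := (hF.hasStrictDerivAt.to_localInverse hF').hasDerivAt.deriv
  have hA₀ := hleft.self_of_nhds
  rw [hF₀] at hA hright hderiv hA₀
  exact ⟨_, hA, hA₀, hderiv ▸ inv_ne_zero hF', hright, hleft⟩

theorem analyticAt_weight (θ : Fin N → ℝ) (n : Fin N) (ho : ‖o‖ ≠ 1) :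
    AnalyticAt ℂ (fun a => weight θ a n) o := by
  have hden : 1 - o * expPos θ n ≠ 0 :=
    (isAdmissible_of_norm_ne θ (a := (o, 1)) (by simpa using ho) n).1
  simp only [weight_apply]
  fun_prop (disch := assumption)

theorem deriv_weight_ne_zero {θ : Fin N → ℝ} {n : Fin N} (hθ : Real.sin (θ n) ≠ 0)
    (ho : ‖o‖ ≠ 1) : deriv (fun a => weight θ a n) o ≠ 0 := by
  have hden : 1 - o * expPos θ n ≠ 0 :=
    (isAdmissible_of_norm_ne θ (a := (o, 1)) (by simpa using ho) n).1
  have hlin (t : ℂ) : HasDerivAt (fun a => 1 - a * t) (-t) o := by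
    simpa using ((hasDerivAt_id o).mul_const t).const_sub 1
  have hsub : expPos θ n - expNeg θ n = 2 * Complex.I * Real.sin (θ n) := by
    simp only [expPos, expNeg, Complex.ofReal_sin, Complex.sin, neg_mul, mul_comm Complex.I]
    linear_combination
      (Complex.exp (θ n * Complex.I) - Complex.exp (-(θ n * Complex.I))) * Complex.I_sq
  have hderiv := (hlin (expNeg θ n)).div (hlin (expPos θ n)) hden
  rw [show (fun a => weight θ a n) = (fun a => 1 - a * expNeg θ n) / fun a => 1 - a * expPos θ n
    from rfl, hderiv.deriv]
  refine div_ne_zero ?_ (pow_ne_zero 2 hden)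
  rw [show -expNeg θ n * (1 - o * expPos θ n) - (1 - o * expNeg θ n) * -expPos θ n =
    expPos θ n - expNeg θ n by ring, hsub]
  exact mul_ne_zero (mul_ne_zero two_ne_zero Complex.I_ne_zero) (Complex.ofReal_ne_zero.2 hθ)

theorem analyticAt_multiplier (hb : IsBasePair o o') : AnalyticAt ℂ (multiplier o o') o := by
  have hden : (o - o') * (o * o - 1) ≠ 0 :=
    mul_ne_zero hb.sub_ne (sq o ▸ hb.sq_sub_one_ne)
  unfold multiplier
  fun_prop (disch := assumption)

theorem multiplier_self (hb : IsBasePair o o') : multiplier o o' o = 1 := by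
  rw [multiplier, ← sq]
  exact div_self (mul_ne_zero hb.sub_ne hb.sq_sub_one_ne)

theorem eventually_isShiftPoint (hb : IsBasePair o o') : ∀ᶠ a in 𝓝 o, IsShiftPoint o o' a := by
  have h₁ : ∀ᶠ a in 𝓝 o, ‖a‖ ≠ 1 := continuous_norm.continuousAt.eventually_ne hb.norm_left
  have h₂ : ∀ᶠ a in 𝓝 o, a - o' ≠ 0 :=
    (by fun_prop : ContinuousAt (fun a => a - o') o).eventually_ne hb.sub_ne
  have h₃ : ∀ᶠ a in 𝓝 o, a * o - 1 ≠ 0 :=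
    (by fun_prop : ContinuousAt (fun a => a * o - 1) o).eventually_ne (sq o ▸ hb.sq_sub_one_ne)
  have h₄ : ∀ᶠ a in 𝓝 o, a * o' - 1 ≠ 0 :=
    (by fun_prop : ContinuousAt (fun a => a * o' - 1) o).eventually_ne hb.mul_sub_ne
  filter_upwards [h₁, h₂, h₃, h₄] with a ha₁ ha₂ ha₃ ha₄ using ⟨ha₁, ha₂, ha₃, ha₄⟩

theorem exp_I_mul_two_arg {w : ℂ} (hw : w ≠ 0) :
    Complex.exp (Complex.I * (2 * Complex.arg w : ℝ)) = w / conj w := by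
  have hpolar : (‖w‖ : ℂ) * Complex.exp (Complex.arg w * Complex.I) = w :=
    Complex.norm_mul_exp_arg_mul_I w
  have hconj : (‖w‖ : ℂ) * Complex.exp (-(Complex.arg w * Complex.I)) = conj w := by
    rw [← congrArg conj hpolar, map_mul, ← Complex.exp_conj, map_mul, Complex.conj_ofReal,
      Complex.conj_ofReal, Complex.conj_I, mul_neg]
  have hnorm : (‖w‖ : ℂ) ≠ 0 := by simpa using hw
  rw [← hconj]
  nth_rewrite 2 [← hpolar]
  rw [mul_div_mul_left _ _ hnorm, ← Complex.exp_sub]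
  congr 1
  push_cast
  ring

theorem exp_I_mul_two_arg_one_sub (θ : Fin N → ℝ) (n : Fin N) {x : ℝ} (hx : ‖(x : ℂ)‖ ≠ 1) :
    Complex.exp (Complex.I * (2 * Complex.arg (1 - x * Complex.exp (-Complex.I * θ n)) : ℝ)) =
      weight θ x n := by
  have hne := (isAdmissible_of_norm_ne θ (a := ((x : ℂ), 1)) (by simpa using hx) n).2
  have h := exp_I_mul_two_arg hne
  rwa [lin, map_sub, map_mul, map_one, Complex.conj_ofReal, conj_expNeg] at h

end HalfDispersion

section IsHalfDispersion

variable {N : ℕ}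

/-- The dispersion data of one half of the hierarchy, with base points `o`, `o'`: a branch `a` of
the solution of `miwaParam κ o o' (a ξ) = ξ` and the coefficients of the phases. -/
structure IsHalfDispersion (κ o o' : ℝ) (θ : Fin N → ℝ) (a : ℝ → ℝ) (nu : Fin N → ℕ → ℝ)
    (phi : ℕ → ℝ) : Prop where
  continuousAt : ContinuousAt a 0
  map_zero : a 0 = o
  param_eq : ∀ᶠ ξ in 𝓝 0, miwaParam κ o o' (a ξ) = ξ
  nu_series : ∀ n, IsGeneratedBy (nu n) fun ξ =>
    2 * Complex.arg (1 - a ξ * Complex.exp (-Complex.I * θ n)) -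
      2 * Complex.arg (1 - o * Complex.exp (-Complex.I * θ n))
  phi_series : IsGeneratedBy phi fun ξ => -Real.log (multiplier o o' (a ξ))

variable {κ o o' : ℝ} {θ : Fin N → ℝ} {a : ℝ → ℝ} {nu : Fin N → ℕ → ℝ} {phi : ℕ → ℝ} {A : ℂ → ℂ}

theorem ofReal_miwaParam (κ o o' a : ℝ) :
    ((miwaParam κ o o' a : ℝ) : ℂ) = miwaParam (κ : ℂ) o o' a := by
  simp [miwaParam]

theorem ofReal_multiplier (o o' a : ℝ) :
    ((multiplier o o' a : ℝ) : ℂ) = multiplier (o : ℂ) o' a := by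
  simp [multiplier]

theorem IsHalfDispersion.exists_branch (h : IsHalfDispersion κ o o' θ a nu phi) (hκ : κ ≠ 0)
    (hb : IsBasePair (o : ℂ) o') :
    ∃ A : ℂ → ℂ, AnalyticAt ℂ A 0 ∧ A 0 = o ∧ deriv A 0 ≠ 0 ∧
      (∀ᶠ z in 𝓝 0, miwaParam (κ : ℂ) o o' (A z) = z) ∧ ∀ᶠ ξ : ℝ in 𝓝 0, (a ξ : ℂ) = A ξ := by
  obtain ⟨A, hA, hA₀, hA', hright, hleft⟩ := DNLS.exists_branch (Complex.ofReal_ne_zero.2 hκ) hb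
  refine ⟨A, hA, hA₀, hA', hright, ?_⟩
  have ha : Tendsto (fun ξ => (a ξ : ℂ)) (𝓝 0) (𝓝 o) :=
    (Complex.continuous_ofReal.tendsto o).comp (h.map_zero ▸ h.continuousAt.tendsto)
  filter_upwards [ha.eventually hleft, h.param_eq] with ξ hξ hparam
  rw [← hξ, ← ofReal_miwaParam, hparam]

theorem IsHalfDispersion.hasShiftFactor_nu (h : IsHalfDispersion κ o o' θ a nu phi)
    (hb : IsBasePair (o : ℂ) o') (hA : AnalyticAt ℂ A 0) (hA₀ : A 0 = o)
    (haA : ∀ᶠ ξ : ℝ in 𝓝 0, (a ξ : ℂ) = A ξ) (n : Fin N) :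
    HasShiftFactor (nu n) 1 (fun z => weight θ (A z) n / weight θ o n) ∧
      HasDerivAt (fun z => weight θ (A z) n / weight θ o n) (1 * Complex.I * nu n 0) 0 := by
  have hweight : AnalyticAt ℂ (fun z => weight θ (A z) n) 0 :=
    (analyticAt_weight θ n (hA₀ ▸ hb.norm_left)).fun_comp hA
  refine (h.nu_series n).hasShiftFactor
    (hweight.div analyticAt_const (weight_ne_zero θ hb.norm_left n)) ?_
  have hne : ∀ᶠ ξ in 𝓝 0, ‖(a ξ : ℂ)‖ ≠ 1 :=
    (Complex.continuous_ofReal.continuousAt.comp h.continuousAt).norm.eventually_ne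
      (by simpa [h.map_zero] using hb.norm_left)
  filter_upwards [haA, hne] with ξ hξ hnorm
  rw [one_mul, Complex.ofReal_sub, mul_sub, Complex.exp_sub,
    exp_I_mul_two_arg_one_sub θ n hnorm, exp_I_mul_two_arg_one_sub θ n hb.norm_left, hξ]

theorem IsHalfDispersion.hasShiftFactor_phi (h : IsHalfDispersion κ o o' θ a nu phi)
    (hb : IsBasePair (o : ℂ) o') (hA : AnalyticAt ℂ A 0) (hA₀ : A 0 = o)
    (haA : ∀ᶠ ξ : ℝ in 𝓝 0, (a ξ : ℂ) = A ξ) :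
    HasShiftFactor phi Complex.I fun z => multiplier (o : ℂ) o' (A z) := by
  have hmul : AnalyticAt ℂ (multiplier (o : ℂ) o') (A 0) := by
    rw [hA₀]
    exact analyticAt_multiplier hb
  have hmulA : AnalyticAt ℂ (fun z => multiplier (o : ℂ) o' (A z)) 0 := hmul.fun_comp hA
  refine (h.phi_series.hasShiftFactor hmulA ?_).1
  have hre : ∀ᶠ ξ : ℝ in 𝓝 0, 0 < (multiplier (o : ℂ) o' (A ξ)).re := by
    refine tendsto_ofReal_nhds_zero.eventually
      ((Complex.continuous_re.continuousAt.comp hmulA.continuousAt).eventually_const_lt ?_)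
    simp [hA₀, multiplier_self hb]
  filter_upwards [haA, hre] with ξ hξ hpos
  rw [← hξ, ← ofReal_multiplier, Complex.ofReal_re] at hpos
  rw [Complex.I_mul_I, Complex.ofReal_neg, neg_one_mul, neg_neg, ← Complex.ofReal_exp,
    Real.exp_log hpos, ofReal_multiplier, hξ]

theorem IsHalfDispersion.exists_shiftPoint (h : IsHalfDispersion κ o o' θ a nu phi)
    (hκ : κ ≠ 0) (hb : IsBasePair (o : ℂ) o') :
    ∃ A : ℂ → ℂ, Tendsto A (𝓝 0) (𝓝 o) ∧
      (∀ᶠ ξ in 𝓝 0, IsShiftPoint (o : ℂ) o' (A ξ) ∧ miwaParam (κ : ℂ) o o' (A ξ) = ξ) ∧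
      HasShiftFactor phi Complex.I (fun ξ => multiplier (o : ℂ) o' (A ξ)) ∧
      ∀ n, HasShiftFactor (nu n) 1 fun ξ => weight θ (A ξ) n / weight θ o n := by
  obtain ⟨A, hA, hA₀, -, hright, haA⟩ := h.exists_branch hκ hb
  have htendsto : Tendsto A (𝓝 0) (𝓝 o) := hA₀ ▸ hA.continuousAt.tendsto
  exact ⟨A, htendsto, (htendsto.eventually (eventually_isShiftPoint hb)).and hright,
    h.hasShiftFactor_phi hb hA hA₀ haA, fun n => (h.hasShiftFactor_nu hb hA hA₀ haA n).1⟩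

theorem IsHalfDispersion.nu_zero_ne_zero (h : IsHalfDispersion κ o o' θ a nu phi) (hκ : κ ≠ 0)
    (hb : IsBasePair (o : ℂ) o') {n : Fin N} (hθ : Real.sin (θ n) ≠ 0) : nu n 0 ≠ 0 := by
  obtain ⟨A, hA, hA₀, hA', -, haA⟩ := h.exists_branch hκ hb
  have hfactor := (h.hasShiftFactor_nu hb hA hA₀ haA n).2
  have hweight := (analyticAt_weight θ n hb.norm_left).differentiableAt.hasDerivAt
  rw [← hA₀] at hweight
  have hchain := (hweight.comp 0 hA.differentiableAt.hasDerivAt).div_const (weight θ (o : ℂ) n)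
  have hderiv := hfactor.unique hchain
  have hne : 1 * Complex.I * (nu n 0 : ℂ) ≠ 0 := by
    rw [hderiv, hA₀]
    exact div_ne_zero (mul_ne_zero (deriv_weight_ne_zero hθ hb.norm_left) hA')
      (weight_ne_zero θ hb.norm_left n)
  simpa using hne

theorem one_sub_mul_exp_mem_slitPlane (x : ℝ) {t : ℝ} (ht : Real.sin t ≠ 0) :
    (1 : ℂ) - x * Complex.exp (-Complex.I * t) ∈ Complex.slitPlane := by
  have him : ((1 : ℂ) - x * Complex.exp (-Complex.I * t)).im = x * Real.sin t := by
    rw [show -Complex.I * (t : ℂ) = ((-t : ℝ) : ℂ) * Complex.I by push_cast; ring,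
      Complex.sub_im, Complex.one_im, Complex.im_ofReal_mul, Complex.exp_ofReal_mul_I_im,
      Real.sin_neg]
    ring
  rcases eq_or_ne x 0 with rfl | hx
  · simp
  · exact Complex.mem_slitPlane_iff.2 (Or.inr (him ▸ mul_ne_zero hx ht))

theorem exists_real_branch (hκ : κ ≠ 0) (hb : IsBasePair (o : ℂ) o') :
    ∃ A : ℂ → ℂ, AnalyticAt ℂ A 0 ∧ A 0 = o ∧
      (∀ᶠ z in 𝓝 0, miwaParam (κ : ℂ) o o' (A z) = z) ∧
      ∀ᶠ ξ : ℝ in 𝓝 0, ((A ξ).re : ℂ) = A ξ := by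
  obtain ⟨A, hA, hA₀, -, hright, hleft⟩ := exists_branch (Complex.ofReal_ne_zero.2 hκ) hb
  refine ⟨A, hA, hA₀, hright, ?_⟩
  have hconj : Tendsto (fun z => conj (A z)) (𝓝 0) (𝓝 o) := by
    have h := (Complex.continuous_conj.tendsto _).comp hA.continuousAt.tendsto
    rwa [hA₀, Complex.conj_ofReal] at h
  filter_upwards [tendsto_ofReal_nhds_zero.eventually (hconj.eventually hleft),
    tendsto_ofReal_nhds_zero.eventually hright] with ξ hl hr
  have hparam : miwaParam (κ : ℂ) o o' (conj (A ξ)) = ξ := by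
    simpa [miwaParam] using congrArg conj hr
  rw [hparam] at hl
  exact Complex.conj_eq_iff_re.1 hl.symm

theorem exists_nu_series (hA : AnalyticAt ℂ A 0) (hA₀ : A 0 = o)
    (hre : ∀ᶠ ξ : ℝ in 𝓝 0, ((A ξ).re : ℂ) = A ξ) {t : ℝ} (ht : Real.sin t ≠ 0) :
    ∃ e, IsGeneratedBy e fun ξ =>
      2 * Complex.arg (1 - (A ξ).re * Complex.exp (-Complex.I * t)) -
        2 * Complex.arg (1 - o * Complex.exp (-Complex.I * t)) := by
  have hlog : AnalyticAt ℂ (fun z => Complex.log (1 - A z * Complex.exp (-Complex.I * t))) 0 :=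
    (analyticAt_const.sub (hA.mul analyticAt_const)).clog
      (by change 1 - A 0 * _ ∈ _; rw [hA₀]; exact one_sub_mul_exp_mem_slitPlane o ht)
  obtain ⟨e, he⟩ := exists_isGeneratedBy_re (F := fun z => -2 * Complex.I *
      (Complex.log (1 - A z * Complex.exp (-Complex.I * t)) -
        Complex.log (1 - o * Complex.exp (-Complex.I * t))))
    (analyticAt_const.mul (hlog.sub analyticAt_const)) (by simp [hA₀])
  refine ⟨e, he.congr ?_⟩
  filter_upwards [hre] with ξ hξ
  rw [hξ]
  simp only [neg_mul, Complex.neg_re, Complex.mul_re, Complex.re_ofNat, Complex.I_re, mul_zero,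
    Complex.im_ofNat, Complex.I_im, mul_one, sub_self, Complex.sub_re, zero_mul, Complex.mul_im,
    add_zero, Complex.sub_im, Complex.log_im, zero_sub, neg_neg]
  ring

theorem exists_phi_series (hb : IsBasePair (o : ℂ) o') (hA : AnalyticAt ℂ A 0) (hA₀ : A 0 = o)
    (hre : ∀ᶠ ξ : ℝ in 𝓝 0, ((A ξ).re : ℂ) = A ξ) :
    ∃ e, IsGeneratedBy e fun ξ => -Real.log (multiplier o o' (A ξ).re) := by
  have hmul : AnalyticAt ℂ (multiplier (o : ℂ) o') (A 0) := by
    rw [hA₀]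
    exact analyticAt_multiplier hb
  have hone : multiplier (o : ℂ) o' (A 0) = 1 := by
    rw [hA₀, multiplier_self hb]
  obtain ⟨e, he⟩ := exists_isGeneratedBy_re
    (F := fun z => -Complex.log (multiplier (o : ℂ) o' (A z)))
    ((hmul.fun_comp hA).clog (hone ▸ Complex.one_mem_slitPlane)).neg (by simp [hone])
  refine ⟨e, he.congr ?_⟩
  filter_upwards [hre] with ξ hξ
  rw [← hξ, ← ofReal_multiplier, Complex.neg_re, Complex.log_re, Complex.norm_real,
    Real.norm_eq_abs, Real.log_abs, Complex.ofReal_re]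

theorem exists_isHalfDispersion (hκ : κ ≠ 0) (hb : IsBasePair (o : ℂ) o')
    (hθ : ∀ n, Real.sin (θ n) ≠ 0) : ∃ a nu phi, IsHalfDispersion κ o o' θ a nu phi := by
  obtain ⟨A, hA, hA₀, hright, hre⟩ := exists_real_branch hκ hb
  choose nu hnu using fun n => exists_nu_series hA hA₀ hre (hθ n)
  obtain ⟨phi, hphi⟩ := exists_phi_series hb hA hA₀ hre
  have hcont : ContinuousAt (fun ξ : ℝ => (A ξ).re) 0 :=
    Complex.continuous_re.continuousAt.comp
      (hA.continuousAt.comp_of_eq Complex.continuous_ofReal.continuousAt Complex.ofReal_zero)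
  refine ⟨fun ξ => (A ξ).re, nu, phi, hcont, by simp [hA₀], ?_, hnu, hphi⟩
  filter_upwards [tendsto_ofReal_nhds_zero.eventually hright, hre] with ξ hr hξ
  rw [← hξ, ← ofReal_miwaParam] at hr
  exact Complex.ofReal_injective hr

end IsHalfDispersion

section IsDispersion

variable {N : ℕ} {μ c : ℝ} {θ : Fin N → ℝ} {d : Dispersion N}

theorem isBasePair_zero (hμ₀ : μ ≠ 0) (hμ₁ : μ ^ 2 ≠ 1) : IsBasePair ((0 : ℝ) : ℂ) μ where
  norm_left := by simp
  norm_right := by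
    rw [Complex.norm_real, Real.norm_eq_abs]
    exact fun h => hμ₁ (by rw [← sq_abs, h, one_pow])
  sub_ne := by simpa using hμ₀
  mul_sub_ne := by simp

theorem miwaParam_zero_left_eq_iff (hμ₀ : μ ≠ 0) {a ξ : ℝ} (hξ : ξ ≠ 0)
    (ha : a - μ ≠ 0) (haμ : a * μ - 1 ≠ 0) :
    miwaParam (-(c * μ ^ 2)) 0 μ a = ξ ↔
      a ≠ 0 ∧ a + a⁻¹ = μ + μ⁻¹ + c * μ * ξ⁻¹ := by
  have hclear : miwaParam (-(c * μ ^ 2)) 0 μ a = ξ ↔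
      c * μ ^ 2 * a = ξ * ((a - μ) * (a * μ - 1)) := by
    rw [miwaParam, div_eq_iff (mul_ne_zero ha haμ)]
    ring_nf
  rw [hclear]
  constructor
  · intro h
    have ha₀ : a ≠ 0 := by
      rintro rfl
      simp [hξ, hμ₀] at h
    refine ⟨ha₀, ?_⟩
    field_simp
    linear_combination -h
  · rintro ⟨ha₀, h⟩
    field_simp at h
    linear_combination -h

theorem miwaParam_zero_right_eq_iff (hμ₀ : μ ≠ 0) (hc : c ≠ 0) {b η : ℝ} (hb : b ≠ 0) :
    miwaParam (-(c * μ ^ 2)⁻¹) μ 0 b = η ↔ b + b⁻¹ = μ + μ⁻¹ + c * μ * η := by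
  rw [miwaParam]
  constructor
  · rintro rfl
    field_simp
    ring
  · intro h
    field_simp at h ⊢
    linear_combination -h

theorem multiplier_zero_left (hμ₀ : μ ≠ 0) (a : ℝ) : multiplier 0 μ a = 1 - μ⁻¹ * a := by
  rw [multiplier]
  field_simp
  ring

theorem multiplier_zero_right (hμ₀ : μ ≠ 0) {b : ℝ} (hb : b ≠ 0) :
    multiplier μ 0 b = (1 - (μ ^ 2)⁻¹) / (1 - μ⁻¹ * b⁻¹) := by
  have h : 1 - μ⁻¹ * b⁻¹ = (b * μ - 1) / (μ * b) := by field_simp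
  rw [multiplier, h]
  field_simp
  ring

theorem eventually_alpha_eq_iff (hμ₀ : μ ≠ 0) {a : ℝ → ℝ} (ha : ContinuousAt a 0)
    (ha₀ : a 0 = 0) :
    (∀ᶠ ξ in 𝓝[≠] 0, a ξ ≠ 0 ∧ a ξ + (a ξ)⁻¹ = μ + μ⁻¹ + c * μ * ξ⁻¹) ↔
      ∀ᶠ ξ in 𝓝 0, miwaParam (-(c * μ ^ 2)) 0 μ (a ξ) = ξ := by
  have hsub : ∀ᶠ ξ in 𝓝 0, a ξ - μ ≠ 0 :=
    (ha.sub continuousAt_const).eventually_ne (by simpa [ha₀] using hμ₀)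
  have hmul : ∀ᶠ ξ in 𝓝 0, a ξ * μ - 1 ≠ 0 :=
    ((ha.mul continuousAt_const).sub continuousAt_const).eventually_ne (by simp [ha₀])
  rw [eventually_nhdsWithin_iff]
  refine eventually_congr ?_
  filter_upwards [hsub, hmul] with ξ h₁ h₂
  rcases eq_or_ne ξ 0 with rfl | hξ
  · simp [ha₀, miwaParam]
  · rw [miwaParam_zero_left_eq_iff hμ₀ hξ h₁ h₂]
    exact forall_prop_of_true hξ

theorem eventually_beta_eq_iff (hμ₀ : μ ≠ 0) (hc : c ≠ 0) {b : ℝ → ℝ}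
    (hb : ∀ᶠ η in 𝓝 0, b η ≠ 0) :
    (∀ᶠ η in 𝓝 0, b η ≠ 0 ∧ b η + (b η)⁻¹ = μ + μ⁻¹ + c * μ * η) ↔
      ∀ᶠ η in 𝓝 0, miwaParam (-(c * μ ^ 2)⁻¹) μ 0 (b η) = η := by
  refine eventually_congr ?_
  filter_upwards [hb] with η hη
  rw [miwaParam_zero_right_eq_iff hμ₀ hc hη, and_iff_right hη]

theorem eventually_neg_log_multiplier_eq (hμ₀ : μ ≠ 0) (hμ₁ : μ ^ 2 ≠ 1) {b : ℝ → ℝ}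
    (hb : ContinuousAt b 0) (hb₀ : b 0 = μ) :
    (fun η => -Real.log (multiplier μ 0 (b η))) =ᶠ[𝓝 0]
      fun η => Real.log (1 - μ⁻¹ * (b η)⁻¹) - Real.log (1 - (μ ^ 2)⁻¹) := by
  have hμ : 1 - (μ ^ 2)⁻¹ ≠ 0 := sub_ne_zero.2 fun h => hμ₁ (inv_eq_one.1 h.symm)
  have hne : ∀ᶠ η in 𝓝 0, b η ≠ 0 := hb.eventually_ne (by rwa [hb₀])
  have hden : ∀ᶠ η in 𝓝 0, 1 - μ⁻¹ * (b η)⁻¹ ≠ 0 := by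
    have hinv : ContinuousAt (fun η => (b η)⁻¹) 0 := hb.inv₀ (by rwa [hb₀])
    exact (continuousAt_const.sub (continuousAt_const.mul hinv)).eventually_ne
      (by simpa [hb₀, ← mul_inv, ← sq] using hμ)
  filter_upwards [hne, hden] with η h₁ h₂
  rw [multiplier_zero_right hμ₀ h₁, Real.log_div hμ h₂, neg_sub]

theorem isDispersion_iff (hμ₀ : μ ≠ 0) (hμ₁ : μ ^ 2 ≠ 1) (hc : c ≠ 0) :
    IsDispersion μ c θ d ↔
      IsHalfDispersion (-(c * μ ^ 2)) 0 μ θ d.alpha d.nu d.phi ∧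
        IsHalfDispersion (-(c * μ ^ 2)⁻¹) μ 0 θ d.beta d.nuBar d.phiBar := by
  have hnu (n : Fin N) : IsGeneratedBy (d.nu n) (fun ξ =>
      2 * Complex.arg (1 - d.alpha ξ * Complex.exp (-Complex.I * θ n)) -
        2 * Complex.arg (1 - (0 : ℝ) * Complex.exp (-Complex.I * θ n))) ↔
      IsGeneratedBy (d.nu n) fun ξ =>
        2 * Complex.arg (1 - d.alpha ξ * Complex.exp (-Complex.I * θ n)) := by
    simp
  have hphi : IsGeneratedBy d.phi (fun ξ => -Real.log (multiplier 0 μ (d.alpha ξ))) ↔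
      IsGeneratedBy d.phi fun ξ => -Real.log (1 - μ⁻¹ * d.alpha ξ) := by
    simp only [multiplier_zero_left hμ₀]
  have hne (hb : ContinuousAt d.beta 0) (hb₀ : d.beta 0 = μ) : ∀ᶠ η in 𝓝 0, d.beta η ≠ 0 :=
    hb.eventually_ne (by rwa [hb₀])
  constructor
  · rintro ⟨ha, ha₀, haeq, hb, hb₀, hbeq, hν, hν', hφ, hφ'⟩
    exact ⟨⟨ha, ha₀, (eventually_alpha_eq_iff hμ₀ ha ha₀).1 haeq,
        fun n => (hnu n).2 (hν n), hphi.2 hφ⟩,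
      ⟨hb, hb₀, (eventually_beta_eq_iff hμ₀ hc (hne hb hb₀)).1 hbeq, hν',
        (isGeneratedBy_congr (eventually_neg_log_multiplier_eq hμ₀ hμ₁ hb hb₀)).2 hφ'⟩⟩
  · rintro ⟨⟨ha, ha₀, haeq, hν, hφ⟩, ⟨hb, hb₀, hbeq, hν', hφ'⟩⟩
    exact ⟨ha, ha₀, (eventually_alpha_eq_iff hμ₀ ha ha₀).2 haeq,
      hb, hb₀, (eventually_beta_eq_iff hμ₀ hc (hne hb hb₀)).2 hbeq,
      fun n => (hnu n).1 (hν n), hν', hphi.1 hφ,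
      (isGeneratedBy_congr (eventually_neg_log_multiplier_eq hμ₀ hμ₁ hb hb₀)).1 hφ'⟩

theorem exists_isDispersion (hμ₀ : μ ≠ 0) (hμ₁ : μ ^ 2 ≠ 1) (hc : c ≠ 0)
    (hθ : ∀ n, Real.sin (θ n) ≠ 0) : ∃ d, IsDispersion μ c θ d := by
  have hb := isBasePair_zero hμ₀ hμ₁
  have hκ : -(c * μ ^ 2) ≠ 0 := neg_ne_zero.2 (mul_ne_zero hc (pow_ne_zero 2 hμ₀))
  have hκ' : -(c * μ ^ 2)⁻¹ ≠ 0 := neg_ne_zero.2 (inv_ne_zero (neg_ne_zero.1 hκ))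
  obtain ⟨alpha, nu, phi, hpos⟩ := exists_isHalfDispersion hκ hb hθ
  obtain ⟨beta, nuBar, phiBar, hneg⟩ := exists_isHalfDispersion hκ' hb.symm hθ
  exact ⟨⟨alpha, beta, nu, nuBar, phi, phiBar⟩, (isDispersion_iff hμ₀ hμ₁ hc).2 ⟨hpos, hneg⟩⟩

end IsDispersion

section WaveState

variable {N : ℕ} {μ c : ℝ} {U₀ : ℂ} {θ C : Fin N → ℝ} {d : Dispersion N} {p q : Times}

/-- The plane wave and the exponentials in the determinant `Δ₂`, as functions of the times. -/
noncomputable def waveState (μ : ℝ) (θ C : Fin N → ℝ) (d : Dispersion N) (p : Times) :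
    WaveState N where
  plane := Complex.exp (Complex.I * phase d p)
  soliton n := C n * Complex.exp (solitonPhase d n p + Complex.I * gammaTwo μ θ n)

theorem exp_I_mul_two_gammaTwo (hμ : ‖(μ : ℂ)‖ ≠ 1) (n : Fin N) :
    Complex.exp (Complex.I * ((2 * gammaTwo μ θ n : ℝ) : ℂ)) * weight θ μ n = 1 := by
  have hneg : Complex.exp (Complex.I * θ n) = Complex.exp (-Complex.I * (-θ : Fin N → ℝ) n) := by
    simp
  rw [gammaTwo, hneg, exp_I_mul_two_arg_one_sub (-θ) n hμ]
  obtain ⟨h₁, h₂⟩ := isAdmissible_of_norm_ne θ (a := ((μ : ℂ), 1)) (by simpa using hμ) n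
  simp only [lin] at h₁ h₂
  simp only [weight_apply, expPos, expNeg] at h₁ h₂ ⊢
  simp only [Pi.neg_apply, Complex.ofReal_neg, neg_mul, mul_neg, neg_neg] at h₁ h₂ ⊢
  field_simp

theorem dualWeight_zero_mul_sq (n : Fin N) : dualWeight θ 0 n * expPos θ n ^ 2 = 1 := by
  have h := expPos_mul_expNeg θ n
  have hne : expPos θ n ≠ 0 := left_ne_zero_of_mul_eq_one h
  simp only [dualWeight, pointWeight, shiftWeight, lin]
  field_simp
  linear_combination -expPos θ n * h

theorem solitonDet_eq (γ : Fin N → ℝ) (p : Times) :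
    solitonDet θ C γ d p =
      solitonTau θ fun n => C n * Complex.exp (solitonPhase d n p + Complex.I * γ n) := by
  rw [solitonDet, solitonTau, tauDet]
  congr 1
  ext m n
  simp only [cscMatrix, of_apply, Matrix.add_apply, one_apply, mul_diagonal, add_right_inj]
  rw [div_eq_mul_inv, mul_comm]

theorem deltaTwo_eq (p : Times) :
    deltaTwo μ θ C d p = solitonTau θ ((waveState μ θ C d p).soliton * weight θ 0) := by
  rw [weight_zero, mul_one, deltaTwo, solitonDet_eq, waveState]

theorem deltaOne_eq (hμ : ‖(μ : ℂ)‖ ≠ 1) (p : Times) :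
    deltaOne μ θ C d p = solitonTau θ
      ((waveState μ θ C d p).soliton * weight θ 0 / crossWeight θ 0 μ) := by
  rw [deltaOne, solitonDet_eq]
  congr 1
  funext n
  have hgamma : Complex.exp (Complex.I * gammaOne μ θ n) =
      Complex.exp (Complex.I * gammaTwo μ θ n) * (weight θ μ n * expPos θ n ^ 2) := by
    have hsplit : Complex.exp (Complex.I * gammaOne μ θ n) *
        Complex.exp (Complex.I * ((2 * gammaTwo μ θ n : ℝ) : ℂ)) =
        Complex.exp (Complex.I * gammaTwo μ θ n) * expPos θ n ^ 2 := by
      rw [expPos, ← Complex.exp_nat_mul, ← Complex.exp_add, ← Complex.exp_add, gammaOne]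
      congr 1
      push_cast
      ring
    linear_combination weight θ μ n * hsplit -
      Complex.exp (Complex.I * gammaOne μ θ n) * exp_I_mul_two_gammaTwo (θ := θ) hμ n
  have hdual := dualWeight_zero_mul_sq (θ := θ) n
  have hne : dualWeight θ 0 n ≠ 0 := left_ne_zero_of_mul_eq_one hdual
  have hw := weight_ne_zero θ hμ n
  simp only [waveState, crossWeight, weight_zero, one_mul, mul_one, Pi.div_apply, Complex.exp_add,
    hgamma]
  field_simp
  linear_combination (C n : ℂ) * hdual

theorem solitonU_eq_field (hμ : ‖(μ : ℂ)‖ ≠ 1) :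
    solitonU μ U₀ θ C d = fun p => field θ 0 μ U₀ (waveState μ θ C d p) := by
  funext p
  rw [solitonU, deltaOne_eq hμ, deltaTwo_eq, field, waveState]

theorem conj_phase (d : Dispersion N) (p : Times) : conj (phase d p.conj) = phase d p := by
  rw [phase, phase, Complex.conj_tsum]
  simp [Times.conj]

theorem conj_solitonPhase (d : Dispersion N) (n : Fin N) (p : Times) :
    conj (solitonPhase d n p.conj) = solitonPhase d n p := by
  rw [solitonPhase, solitonPhase, Complex.conj_tsum]
  simp [Times.conj]

theorem waveState_isReflection (hμ : ‖(μ : ℂ)‖ ≠ 1) (p : Times) :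
    (waveState μ θ C d p).IsReflection θ 0 μ (waveState μ θ C d p.conj) where
  plane := by
    rw [waveState, waveState, ← Complex.exp_conj, ← Complex.exp_neg, map_mul, conj_phase,
      Complex.conj_I, neg_mul]
  soliton n := by
    have hsplit : Complex.exp (solitonPhase d n p + -Complex.I * gammaTwo μ θ n) *
        Complex.exp (Complex.I * ((2 * gammaTwo μ θ n : ℝ) : ℂ)) =
        Complex.exp (solitonPhase d n p + Complex.I * gammaTwo μ θ n) := by
      rw [← Complex.exp_add]
      congr 1
      push_cast
      ring
    simp only [waveState, map_mul, Complex.conj_ofReal, ← Complex.exp_conj, map_add,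
      conj_solitonPhase, Complex.conj_I, weight_zero, Pi.one_apply, one_mul]
    linear_combination C n * weight θ μ n * hsplit -
      C n * Complex.exp (solitonPhase d n p + -Complex.I * gammaTwo μ θ n) *
        exp_I_mul_two_gammaTwo (θ := θ) hμ n

theorem WaveState.IsReflection.symm {o o' : ℂ} {s s' : WaveState N}
    (h : s.IsReflection θ o o' s') : s.IsReflection θ o' o s' :=
  ⟨h.plane, fun n => (h.soliton n).trans (by rw [mul_comm (weight θ o n)])⟩

theorem mem_regularDomain_iff (hb : IsBasePair (0 : ℂ) μ) (p : Times) :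
    p ∈ regularDomain μ θ C d ↔
      p ∈ convergenceDomain d ∧ (waveState μ θ C d p).IsRegular θ 0 μ := by
  have hconj := conj_solitonTau_mul_weight hb (map_zero _)
    (waveState_isReflection (θ := θ) (C := C) (d := d) hb.norm_right p)
  rw [WaveState.IsRegular, ← hconj, map_ne_zero, ← deltaTwo_eq, ← deltaTwo_eq]
  rfl

theorem conj_mem_regularDomain (hp : p ∈ regularDomain μ θ C d) :
    p.conj ∈ regularDomain μ θ C d := by
  refine ⟨?_, hp.2.2, by rw [Times.conj_conj]; exact hp.2.1⟩
  have hsummable {e e' : ℕ → ℝ} (h : Summable fun k => (e k : ℂ) * p.pos k + e' k * p.neg k) :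
      Summable fun k => (e k : ℂ) * p.conj.pos k + e' k * p.conj.neg k := by
    simpa [Times.conj, Function.comp_def] using h.map (starRingEnd ℂ) Complex.continuous_conj
  exact ⟨hsummable hp.1.1, fun n => hsummable (hp.1.2 n)⟩

end WaveState

section SmallShifts

variable {N : ℕ} {μ : ℝ} {θ C : Fin N → ℝ} {d : Dispersion N} {p : Times} {ξ S : ℂ}
  {e e' : ℕ → ℝ}

theorem hasSum_shiftPos (h : Summable fun k => (e k : ℂ) * p.pos k + e' k * p.neg k)
    (hS : HasSum (fun k : ℕ => (e k : ℂ) * (Complex.I * ξ ^ (k + 1) / ((k : ℂ) + 1))) S) :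
    HasSum (fun k => (e k : ℂ) * (shiftPos ξ p).pos k + e' k * (shiftPos ξ p).neg k)
      ((∑' k, ((e k : ℂ) * p.pos k + e' k * p.neg k)) + S) := by
  simpa only [shiftPos, mul_add, add_right_comm] using h.hasSum.add hS

theorem hasSum_shiftNeg (h : Summable fun k => (e k : ℂ) * p.pos k + e' k * p.neg k)
    (hS : HasSum (fun k : ℕ => (e' k : ℂ) * (Complex.I * ξ ^ (k + 1) / ((k : ℂ) + 1))) S) :
    HasSum (fun k => (e k : ℂ) * (shiftNeg ξ p).pos k + e' k * (shiftNeg ξ p).neg k)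
      ((∑' k, ((e k : ℂ) * p.pos k + e' k * p.neg k)) + S) := by
  simpa only [shiftNeg, mul_add, add_assoc] using h.hasSum.add hS

/-- All sufficiently small shifts `T ξ` preserve `D` and act on the wave states `S` as the shifts
attached to regular points `b ξ`, which tend to `o` as `ξ` tends to `0`. -/
def RealizesSmallShifts (θ : Fin N → ℝ) (κ o o' : ℂ) (T : ℂ → Times → Times) (D : Set Times)
    (S : Times → WaveState N) : Prop :=
  ∃ b : ℂ → ℂ, Tendsto b (𝓝 0) (𝓝 o) ∧ ∀ᶠ ξ in 𝓝 0, IsShiftPoint o o' (b ξ) ∧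
    miwaParam κ o o' (b ξ) = ξ ∧ ∀ p ∈ D, T ξ p ∈ D ∧ S (T ξ p) = (S p).shift θ o o' (b ξ)

theorem RealizesSmallShifts.exists_forall_realizesShift {κ o o' : ℂ} {T : ℂ → Times → Times}
    {D D' : Set Times} {S : Times → WaveState N} (h : RealizesSmallShifts θ κ o o' T D S)
    (hD : D' ⊆ D) : ∃ r, 0 < r ∧ ∀ ξ, ‖ξ‖ < r → RealizesShift θ κ o o' T D' S ξ := by
  obtain ⟨b, -, hb⟩ := h
  obtain ⟨r, hr, hball⟩ := Metric.eventually_nhds_iff.1 hb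
  refine ⟨r, hr, fun ξ hξ => ?_⟩
  obtain ⟨hpoint, hparam, hshift⟩ := hball (by rwa [dist_zero_right])
  exact ⟨b ξ, hpoint, hparam, fun p hp => (hshift p (hD hp)).2⟩

theorem IsHalfDispersion.realizesSmallShifts {κ o o' : ℝ} {a : ℝ → ℝ} {nu : Fin N → ℕ → ℝ}
    {phi : ℕ → ℝ} {T : ℂ → Times → Times} (h : IsHalfDispersion κ o o' θ a nu phi) (hκ : κ ≠ 0)
    (hb : IsBasePair (o : ℂ) o')
    (hphi : ∀ p ∈ convergenceDomain d, ∀ ξ S,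
      HasSum (fun k : ℕ => (phi k : ℂ) * (Complex.I * ξ ^ (k + 1) / ((k : ℂ) + 1))) S →
        HasSum (fun k => (d.phi k : ℂ) * (T ξ p).pos k + d.phiBar k * (T ξ p).neg k)
          (phase d p + S))
    (hnu : ∀ p ∈ convergenceDomain d, ∀ n ξ S,
      HasSum (fun k : ℕ => (nu n k : ℂ) * (Complex.I * ξ ^ (k + 1) / ((k : ℂ) + 1))) S →
        HasSum (fun k => (d.nu n k : ℂ) * (T ξ p).pos k + d.nuBar n k * (T ξ p).neg k)
          (solitonPhase d n p + S)) :
    RealizesSmallShifts θ κ o o' T (convergenceDomain d) (waveState μ θ C d) := by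
  obtain ⟨b, hb₀, hpoint, hmul, hweight⟩ := h.exists_shiftPoint hκ hb
  refine ⟨b, hb₀, ?_⟩
  filter_upwards [hpoint, hmul, eventually_all.2 hweight] with ξ ⟨hξ, hparam⟩ hmulξ hweightξ
  obtain ⟨S, hS, hSexp⟩ := hmulξ
  choose R hR hRexp using hweightξ
  refine ⟨hξ, hparam, fun p hp =>
    ⟨⟨(hphi p hp ξ S hS).summable, fun n => (hnu p hp n ξ (R n) (hR n)).summable⟩, ?_⟩⟩
  have hphase : phase d (T ξ p) = phase d p + S := (hphi p hp ξ S hS).tsum_eq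
  have hsoliton (n : Fin N) : solitonPhase d n (T ξ p) = solitonPhase d n p + R n :=
    (hnu p hp n ξ (R n) (hR n)).tsum_eq
  ext n
  · rw [waveState, WaveState.shift, waveState, hphase, mul_add, Complex.exp_add, hSexp]
  · rw [waveState, WaveState.shift, waveState]
    simp only [Pi.div_apply, Pi.mul_apply]
    rw [hsoliton, mul_div_assoc, ← hRexp n, one_mul, mul_assoc, ← Complex.exp_add]
    ring_nf

theorem IsDispersion.realizesSmallShifts_shiftPos {c : ℝ} (hμ₀ : μ ≠ 0) (hμ₁ : μ ^ 2 ≠ 1)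
    (hc : c ≠ 0) (hd : IsDispersion μ c θ d) :
    RealizesSmallShifts θ ((-(c * μ ^ 2) : ℝ) : ℂ) 0 μ shiftPos (convergenceDomain d)
      (waveState μ θ C d) := by
  have hhalf := ((isDispersion_iff hμ₀ hμ₁ hc).1 hd).1
  rw [← Complex.ofReal_zero]
  exact hhalf.realizesSmallShifts (neg_ne_zero.2 (mul_ne_zero hc (pow_ne_zero 2 hμ₀)))
    (isBasePair_zero hμ₀ hμ₁) (fun p hp _ _ => hasSum_shiftPos hp.1)
    fun p hp n _ _ => hasSum_shiftPos (hp.2 n)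

theorem IsDispersion.realizesSmallShifts_shiftNeg {c : ℝ} (hμ₀ : μ ≠ 0) (hμ₁ : μ ^ 2 ≠ 1)
    (hc : c ≠ 0) (hd : IsDispersion μ c θ d) :
    RealizesSmallShifts θ ((-(c * μ ^ 2)⁻¹ : ℝ) : ℂ) μ 0 shiftNeg (convergenceDomain d)
      (waveState μ θ C d) := by
  have hhalf := ((isDispersion_iff hμ₀ hμ₁ hc).1 hd).2
  rw [← Complex.ofReal_zero]
  exact hhalf.realizesSmallShifts
    (neg_ne_zero.2 (inv_ne_zero (mul_ne_zero hc (pow_ne_zero 2 hμ₀))))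
    (isBasePair_zero hμ₀ hμ₁).symm (fun p hp _ _ => hasSum_shiftNeg hp.1)
    fun p hp n _ _ => hasSum_shiftNeg (hp.2 n)

end SmallShifts

section Hierarchy

variable {N : ℕ} {μ c r : ℝ} {U₀ : ℂ} {θ C : Fin N → ℝ} {d : Dispersion N}

theorem reflect_field {o o' : ℂ} {S : Times → WaveState N} (hb : IsBasePair o o')
    (ho : conj o = o) (ho' : conj o' = o') (P : ℂ)
    (hS : ∀ p, (S p).IsReflection θ o o' (S p.conj)) :
    reflect (fun p => field θ o o' P (S p)) = fun p => cofield θ o o' (conj P) (S p) :=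
  funext fun p => conj_field hb ho ho' P (hS p)

/-- The partner `u` of the solution `U` in the extended hierarchy. -/
noncomputable def companionU (μ c : ℝ) (U₀ : ℂ) (θ C : Fin N → ℝ) (d : Dispersion N)
    (p : Times) : ℂ :=
  field θ μ 0 (c * μ ^ 2 / (μ ^ 2 - 1) * U₀) (waveState μ θ C d p)

theorem amplitude_relations (hμ : (μ : ℂ) ^ 2 - 1 ≠ 0) (hcU : (c : ℂ) * (U₀ * conj U₀) = 1) :
    ((-(c * μ ^ 2) : ℝ) : ℂ) * (U₀ * conj U₀) * ((0 : ℂ) ^ 2 - 1) ^ 2 = -(0 - (μ : ℂ)) ^ 2 ∧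
      ((-(c * μ ^ 2) : ℝ) : ℂ) * U₀ * ((0 : ℂ) ^ 2 - 1) =
        c * μ ^ 2 / (μ ^ 2 - 1) * U₀ * ((μ : ℂ) ^ 2 - 1) := by
  push_cast
  refine ⟨by linear_combination -(μ : ℂ) ^ 2 * hcU, ?_⟩
  field_simp
  ring

theorem companion_amplitude_relations (hμ₀ : (μ : ℂ) ≠ 0) (hμ : (μ : ℂ) ^ 2 - 1 ≠ 0)
    (hcU : (c : ℂ) * (U₀ * conj U₀) = 1) :
    ((-(c * μ ^ 2)⁻¹ : ℝ) : ℂ) * (c * μ ^ 2 / (μ ^ 2 - 1) * U₀ *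
        conj (c * μ ^ 2 / (μ ^ 2 - 1) * U₀)) * ((μ : ℂ) ^ 2 - 1) ^ 2 = -((μ : ℂ) - 0) ^ 2 ∧
      ((-(c * μ ^ 2)⁻¹ : ℝ) : ℂ) * (c * μ ^ 2 / (μ ^ 2 - 1) * U₀) * ((μ : ℂ) ^ 2 - 1) =
        U₀ * ((0 : ℂ) ^ 2 - 1) := by
  have hc : (c : ℂ) ≠ 0 := left_ne_zero_of_mul_eq_one hcU
  simp only [map_mul, map_div₀, map_sub, map_pow, map_one, Complex.conj_ofReal]
  push_cast
  constructor
  · field_simp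
    linear_combination -(μ : ℂ) ^ 2 * hcU
  · field_simp
    ring

theorem isExtendedDNLSH_of_realizesShift (hθ : ∀ m n, Real.sin ((θ m + θ n) / 2) ≠ 0)
    (hμ₀ : μ ≠ 0) (hb : IsBasePair (0 : ℂ) μ) (hcU : (c : ℂ) * (U₀ * conj U₀) = 1)
    (hpos : ∀ ξ, ‖ξ‖ < r → RealizesShift θ ((-(c * μ ^ 2) : ℝ) : ℂ) 0 μ shiftPos
      (regularDomain μ θ C d) (waveState μ θ C d) ξ)
    (hneg : ∀ ξ, ‖ξ‖ < r → RealizesShift θ ((-(c * μ ^ 2)⁻¹ : ℝ) : ℂ) μ 0 shiftNeg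
      (regularDomain μ θ C d) (waveState μ θ C d) ξ) :
    IsExtendedDNLSH (regularDomain μ θ C d) r (solitonU μ U₀ θ C d)
      (reflect (solitonU μ U₀ θ C d)) (companionU μ c U₀ θ C d)
      (reflect (companionU μ c U₀ θ C d)) := by
  have hμ : (μ : ℂ) ≠ 0 := Complex.ofReal_ne_zero.2 hμ₀
  have hsq : (μ : ℂ) ^ 2 - 1 ≠ 0 := hb.symm.sq_sub_one_ne
  have hreg (p) (hp : p ∈ regularDomain μ θ C d) :
      (waveState μ θ C d p).plane ≠ 0 ∧ (waveState μ θ C d p).IsRegular θ 0 μ :=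
    ⟨Complex.exp_ne_zero _, ((mem_regularDomain_iff hb p).1 hp).2⟩
  have hreg' (p) (hp : p ∈ regularDomain μ θ C d) :
      (waveState μ θ C d p).plane ≠ 0 ∧ (waveState μ θ C d p).IsRegular θ μ 0 :=
    ⟨(hreg p hp).1, (hreg p hp).2.symm⟩
  have hV := reflect_field hb (map_zero _) (Complex.conj_ofReal μ) U₀
    (waveState_isReflection (θ := θ) (C := C) (d := d) hb.norm_right)
  have hv := reflect_field hb.symm (Complex.conj_ofReal μ) (map_zero _)
    (c * μ ^ 2 / (μ ^ 2 - 1) * U₀)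
    fun p => (waveState_isReflection (θ := θ) (C := C) (d := d) hb.norm_right p).symm
  obtain ⟨hposPQ, hposP⟩ := amplitude_relations hsq hcU
  obtain ⟨hnegPQ, hnegP⟩ := companion_amplitude_relations hμ hsq hcU
  unfold companionU
  rw [solitonU_eq_field hb.norm_right]
  apply IsExtendedDNLSH.of_reflect fun _ => conj_mem_regularDomain
  · rw [hV]
    exact solvesPure_field hθ hb hposPQ hpos hreg
  · rw [hv]
    exact solvesPure_field hθ hb.symm hnegPQ hneg hreg'
  · rw [hv]
    exact solvesMixed_field hθ hb.symm hnegPQ hnegP hneg hreg'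
  · rw [hV]
    exact solvesMixed_field hθ hb hposPQ hposP hpos hreg

theorem exists_isExtendedDNLSH (hθ : ∀ m n, Real.sin ((θ m + θ n) / 2) ≠ 0) (hμ₀ : μ ≠ 0)
    (hμ₁ : μ ^ 2 ≠ 1) (hcU : (c : ℂ) * (U₀ * conj U₀) = 1) (hd : IsDispersion μ c θ d) :
    ∃ r, 0 < r ∧ IsExtendedDNLSH (regularDomain μ θ C d) r (solitonU μ U₀ θ C d)
      (reflect (solitonU μ U₀ θ C d)) (companionU μ c U₀ θ C d)
      (reflect (companionU μ c U₀ θ C d)) := by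
  have hc : c ≠ 0 := Complex.ofReal_ne_zero.1 (left_ne_zero_of_mul_eq_one hcU)
  have hb : IsBasePair (0 : ℂ) μ := by simpa using isBasePair_zero hμ₀ hμ₁
  obtain ⟨r, hr, hpos⟩ := (hd.realizesSmallShifts_shiftPos (C := C) hμ₀ hμ₁
    hc).exists_forall_realizesShift (D' := regularDomain μ θ C d) fun _ hp => hp.1
  obtain ⟨r', hr', hneg⟩ := (hd.realizesSmallShifts_shiftNeg (C := C) hμ₀ hμ₁
    hc).exists_forall_realizesShift (D' := regularDomain μ θ C d) fun _ hp => hp.1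
  exact ⟨min r r', lt_min hr hr', isExtendedDNLSH_of_realizesShift hθ hμ₀ hb hcU
    (fun ξ hξ => hpos ξ (hξ.trans_le (min_le_left _ _)))
    fun ξ hξ => hneg ξ (hξ.trans_le (min_le_right _ _))⟩

end Hierarchy

section Stability

variable {N : ℕ} {μ c : ℝ} {θ C : Fin N → ℝ} {d : Dispersion N} {o o' : ℂ}

theorem continuous_solitonTau (θ : Fin N → ℝ) : Continuous (solitonTau θ) := by
  unfold solitonTau tauDet
  fun_prop

theorem WaveState.tendsto_soliton_shift {α : Type*} {l : Filter α} {a : α → ℂ}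
    {s : α → WaveState N} {X : Fin N → ℂ} (ho : ‖o‖ ≠ 1) (ha : Tendsto a l (𝓝 o))
    (hs : Tendsto (fun x => (s x).soliton) l (𝓝 X)) :
    Tendsto (fun x => ((s x).shift θ o o' (a x)).soliton) l (𝓝 X) := by
  refine tendsto_pi_nhds.2 fun n => ?_
  have hw := weight_ne_zero θ ho n
  have h := ((tendsto_pi_nhds.1 hs n).mul
    ((analyticAt_weight θ n ho).continuousAt.tendsto.comp ha)).div_const (weight θ o n)
  rwa [mul_div_cancel_right₀ _ hw] at h

theorem WaveState.IsRegular.eventually {α : Type*} {l : Filter α} {s : WaveState N}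
    {F : α → WaveState N} (hs : s.IsRegular θ o o')
    (hF : Tendsto (fun x => (F x).soliton) l (𝓝 s.soliton)) :
    ∀ᶠ x in l, (F x).IsRegular θ o o' := by
  have htau (b : ℂ) : Tendsto (fun x => solitonTau θ ((F x).soliton * weight θ b)) l
      (𝓝 (solitonTau θ (s.soliton * weight θ b))) :=
    ((continuous_solitonTau θ).tendsto _).comp (hF.mul_const _)
  exact ((htau o).eventually_ne hs.1).and ((htau o').eventually_ne hs.2)

theorem eventually_shift_shift_mem_regularDomain {κ₁ o₁ o₁' κ₂ o₂ o₂' : ℂ}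
    {T₁ T₂ : ℂ → Times → Times} (hb : IsBasePair (0 : ℂ) μ) (ho₁ : ‖o₁‖ ≠ 1) (ho₂ : ‖o₂‖ ≠ 1)
    (h₁ : RealizesSmallShifts θ κ₁ o₁ o₁' T₁ (convergenceDomain d) (waveState μ θ C d))
    (h₂ : RealizesSmallShifts θ κ₂ o₂ o₂' T₂ (convergenceDomain d) (waveState μ θ C d))
    {p : Times} (hp : p ∈ regularDomain μ θ C d) :
    ∀ᶠ q : ℂ × ℂ in 𝓝 (0, 0), T₁ q.1 (T₂ q.2 p) ∈ regularDomain μ θ C d := by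
  obtain ⟨b₁, hb₁, hT₁⟩ := h₁
  obtain ⟨b₂, hb₂, hT₂⟩ := h₂
  have hfst : Tendsto Prod.fst (𝓝 ((0 : ℂ), (0 : ℂ))) (𝓝 0) := continuous_fst.tendsto _
  have hsnd : Tendsto Prod.snd (𝓝 ((0 : ℂ), (0 : ℂ))) (𝓝 0) := continuous_snd.tendsto _
  have hreg := ((mem_regularDomain_iff hb p).1 hp).2.eventually
    (WaveState.tendsto_soliton_shift (θ := θ) (o' := o₁') ho₁ (hb₁.comp hfst)
      (WaveState.tendsto_soliton_shift (θ := θ) (o' := o₂') ho₂ (hb₂.comp hsnd)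
        tendsto_const_nhds))
  filter_upwards [hfst.eventually hT₁, hsnd.eventually hT₂, hreg] with q hq₁ hq₂ hq
  obtain ⟨hmem₂, hstate₂⟩ := hq₂.2.2 p hp.1
  obtain ⟨hmem₁, hstate₁⟩ := hq₁.2.2 _ hmem₂
  rw [mem_regularDomain_iff hb, hstate₁, hstate₂]
  exact ⟨hmem₁, hq⟩

theorem isShiftStable_regularDomain (hμ₀ : μ ≠ 0) (hμ₁ : μ ^ 2 ≠ 1) (hc : c ≠ 0)
    (hd : IsDispersion μ c θ d) : IsShiftStable (regularDomain μ θ C d) := by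
  intro p hp
  have hb : IsBasePair (0 : ℂ) μ := by simpa using isBasePair_zero hμ₀ hμ₁
  have hpos := hd.realizesSmallShifts_shiftPos (C := C) hμ₀ hμ₁ hc
  have hneg := hd.realizesSmallShifts_shiftNeg (C := C) hμ₀ hμ₁ hc
  exact (eventually_shift_shift_mem_regularDomain hb hb.norm_left hb.norm_left hpos hpos hp).and
    ((eventually_shift_shift_mem_regularDomain hb hb.norm_right hb.norm_right hneg hneg hp).and
      (eventually_shift_shift_mem_regularDomain hb hb.norm_left hb.norm_right hpos hneg hp))

end Stability

section Cauchy

open Polynomial in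
theorem eq_zero_of_sum_div_eq_zero {K ι : Type*} [Field K] [Fintype ι]
    {p q x : ι → K} (hp : Function.Injective p) (hq : Function.Injective q)
    (hpq : ∀ m n, p n ≠ q m) (h : ∀ m, ∑ n, x n / (p n - q m) = 0) : x = 0 := by
  classical
  let R : K[X] := ∑ n, C (x n) * Lagrange.nodal (Finset.univ.erase n) p
  have hdeg : R.degree < (Finset.univ : Finset ι).card := by
    refine mem_degreeLT.1 (Submodule.sum_mem _ fun n hn => ?_)
    rw [← smul_eq_C_mul]
    refine Submodule.smul_mem _ _ (mem_degreeLT.2 ?_)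
    rw [Lagrange.degree_nodal, Nat.cast_lt]
    exact Finset.card_erase_lt_of_mem hn
  have hR : R = 0 := by
    refine eq_zero_of_degree_lt_of_eval_index_eq_zero _ hq.injOn hdeg fun m _ => ?_
    have hterm (n : ι) : (C (x n) * Lagrange.nodal (Finset.univ.erase n) p).eval (q m) =
        -(Lagrange.nodal Finset.univ p).eval (q m) * (x n / (p n - q m)) := by
      have hsub : p n - q m ≠ 0 := sub_ne_zero.2 (hpq m n)
      rw [Lagrange.nodal_eq_mul_nodal_erase (Finset.mem_univ n)]
      simp only [eval_mul, eval_C, eval_sub, eval_X]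
      field_simp
      ring
    rw [eval_finsetSum, Finset.sum_congr rfl fun n _ => hterm n, ← Finset.mul_sum, h m, mul_zero]
  funext n
  have heval : R.eval (p n) = x n * (Lagrange.nodal (Finset.univ.erase n) p).eval (p n) := by
    rw [eval_finsetSum, Finset.sum_eq_single_of_mem n (Finset.mem_univ n), eval_mul, eval_C]
    intro k _ hkn
    rw [eval_mul, Lagrange.eval_nodal_at_node (Finset.mem_erase.2 ⟨hkn.symm, Finset.mem_univ n⟩),
      mul_zero]
  rw [hR, eval_zero] at heval
  exact (mul_eq_zero.1 heval.symm).resolve_right <| Lagrange.eval_nodal_not_at_node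
    fun k hk hpk => Finset.ne_of_mem_erase hk (hp hpk.symm)

theorem det_ne_zero_of_displacement {K ι : Type*} [Field K] [Fintype ι] [DecidableEq ι]
    {A : Matrix ι ι K} {p q x y : ι → K} (hp : Function.Injective p) (hq : Function.Injective q)
    (hpq : ∀ m n, p n ≠ q m) (hx : ∀ m, x m ≠ 0) (hy : ∀ n, y n ≠ 0)
    (hA : ∀ m n, A m n * (p n - q m) = x m * y n) : A.det ≠ 0 := by
  intro hdet
  obtain ⟨v, hv, hAv⟩ := exists_mulVec_eq_zero_iff.2 hdet
  have hyv : (fun n => y n * v n) = 0 := by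
    refine eq_zero_of_sum_div_eq_zero hp hq hpq fun m => mul_left_cancel₀ (hx m) ?_
    have hrow : ∑ n, A m n * v n = 0 := congrFun hAv m
    rw [mul_zero, ← hrow, Finset.mul_sum]
    refine Finset.sum_congr rfl fun n _ => ?_
    have hsub : p n - q m ≠ 0 := sub_ne_zero.2 (hpq m n)
    field_simp
    linear_combination -v n * hA m n
  exact hv (funext fun n => (mul_eq_zero.1 (congrFun hyv n)).resolve_left (hy n))

variable {N : ℕ} {θ : Fin N → ℝ}

theorem expPos_injective (hθ : ∀ m n, m ≠ n → Real.sin ((θ m - θ n) / 2) ≠ 0) :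
    Function.Injective (expPos θ) := by
  intro m n h
  by_contra hmn
  obtain ⟨k, hk⟩ := Complex.exp_eq_exp_iff_exists_int.1 h
  have hangle : ((θ m : ℝ) : ℂ) = ((θ n + k * (2 * Real.pi) : ℝ) : ℂ) := by
    push_cast
    refine mul_left_cancel₀ Complex.I_ne_zero ?_
    linear_combination hk
  refine hθ m n hmn ?_
  rw [Complex.ofReal_inj.1 hangle, add_sub_cancel_left, mul_div_assoc,
    mul_div_cancel_left₀ _ two_ne_zero, Real.sin_int_mul_pi]

theorem expNeg_injective (hθ : ∀ m n, m ≠ n → Real.sin ((θ m - θ n) / 2) ≠ 0) :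
    Function.Injective (expNeg θ) := by
  intro m n h
  apply expPos_injective hθ
  rw [← conj_expNeg, ← conj_expNeg, h]

theorem expPos_ne_expNeg (hθ : ∀ m n, Real.sin ((θ m + θ n) / 2) ≠ 0) (m n : Fin N) :
    expPos θ n ≠ expNeg θ m := by
  intro h
  have hsin := sin_half_add_mul θ m n
  rw [h, sub_self, mul_zero] at hsin
  exact mul_ne_zero (Complex.ofReal_ne_zero.2 (hθ m n))
    (mul_ne_zero two_ne_zero Complex.I_ne_zero) hsin

/-- The coefficients of the columns of `1 + A diag X` that dominate when the `X n` with `n ∈ I` tend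
to infinity and the others to `0`. -/
noncomputable def leadingMatrix (A : Matrix (Fin N) (Fin N) ℂ) (I : Finset (Fin N)) :
    Matrix (Fin N) (Fin N) ℂ :=
  of fun m n => if n ∈ I then A m n else (1 : Matrix (Fin N) (Fin N) ℂ) m n

theorem det_leadingMatrix_cscMatrix_ne_zero (hθ : ∀ m n, Real.sin ((θ m + θ n) / 2) ≠ 0)
    (hθ' : ∀ m n, m ≠ n → Real.sin ((θ m - θ n) / 2) ≠ 0) (I : Finset (Fin N)) :
    (leadingMatrix (cscMatrix θ) I).det ≠ 0 := by
  have hone : (leadingMatrix (cscMatrix θ) I).toSquareBlockProp (fun n => n ∉ I) = 1 := by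
    ext m n
    simp [leadingMatrix, toSquareBlockProp_def, n.2, one_apply, Subtype.ext_iff]
  have hblock : ((leadingMatrix (cscMatrix θ) I).toSquareBlockProp (· ∈ I)).det ≠ 0 := by
    refine det_ne_zero_of_displacement (p := fun n => expPos θ n) (q := fun m => expNeg θ m)
      ((expPos_injective hθ').comp Subtype.val_injective)
      ((expNeg_injective hθ').comp Subtype.val_injective) (fun m n => expPos_ne_expNeg hθ m n)
      (fun m => inv_ne_zero (Complex.exp_ne_zero (Complex.I * θ m / 2)))
      (fun n => mul_ne_zero (mul_ne_zero (mul_ne_zero two_ne_zero Complex.I_ne_zero)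
        (inv_ne_zero (Complex.exp_ne_zero (-(Complex.I * θ n / 2))))) one_ne_zero) fun m n => ?_
    have hdisp := cscMatrix_displacement hθ 1 m n
    rw [mul_diagonal, Pi.one_apply, mul_one] at hdisp
    simpa [leadingMatrix, toSquareBlockProp_def, n.2] using hdisp
  rw [twoBlockTriangular_det' _ (· ∈ I) fun m hm n hn => ?_, hone, det_one, mul_one]
  · convert hblock
  · simp [leadingMatrix, hn, one_apply_ne (ne_of_mem_of_not_mem hm hn)]

end Cauchy

section Boundary

variable {N : ℕ} {μ c : ℝ} {U₀ : ℂ} {θ C : Fin N → ℝ} {d : Dispersion N}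

theorem tendsto_prod_inv_mul_solitonTau {α : Type*} {l : Filter α} {I : Finset (Fin N)}
    {X : α → Fin N → ℂ} (hI : ∀ n ∈ I, Tendsto (fun x => X x n) l (Bornology.cobounded ℂ))
    (hI' : ∀ n ∉ I, Tendsto (fun x => X x n) l (𝓝 0)) :
    Tendsto (fun x => (∏ n ∈ I, (X x n)⁻¹) * solitonTau θ (X x)) l
      (𝓝 (leadingMatrix (cscMatrix θ) I).det) := by
  have hscaled (x : α) : (∏ n ∈ I, (X x n)⁻¹) * solitonTau θ (X x) =
      (of fun m n => (if n ∈ I then (X x n)⁻¹ else 1) *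
        (1 + cscMatrix θ * diagonal (X x)) m n).det := by
    rw [det_mul_row, Finset.prod_ite_mem, Finset.univ_inter, solitonTau, tauDet]
  simp only [hscaled]
  refine (continuous_id.matrix_det.tendsto (leadingMatrix (cscMatrix θ) I)).comp
    (tendsto_pi_nhds.2 fun m => tendsto_pi_nhds.2 fun n => ?_)
  simp only [of_apply, Matrix.add_apply, mul_diagonal, leadingMatrix]
  by_cases hn : n ∈ I
  · simp only [if_pos hn]
    have hinv : Tendsto (fun x => (X x n)⁻¹) l (𝓝 0) := tendsto_inv₀_cobounded.comp (hI n hn)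
    have hlim := (hinv.mul_const ((1 : Matrix (Fin N) (Fin N) ℂ) m n)).add_const (cscMatrix θ m n)
    rw [zero_mul, zero_add] at hlim
    refine hlim.congr' ?_
    filter_upwards [(hI n hn).eventually_ne_cobounded 0] with x hx
    field_simp
  · simpa [hn] using ((hI' n hn).const_mul (cscMatrix θ m n)).const_add
      ((1 : Matrix (Fin N) (Fin N) ℂ) m n)

theorem tendsto_solitonTau_div_solitonTau (hθ : ∀ m n, Real.sin ((θ m + θ n) / 2) ≠ 0)
    (hθ' : ∀ m n, m ≠ n → Real.sin ((θ m - θ n) / 2) ≠ 0) {α : Type*} {l : Filter α}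
    {I : Finset (Fin N)} {X : α → Fin N → ℂ} {J : Fin N → ℂ} (hJ : ∀ n, J n ≠ 0)
    (hI : ∀ n ∈ I, Tendsto (fun x => X x n) l (Bornology.cobounded ℂ))
    (hI' : ∀ n ∉ I, Tendsto (fun x => X x n) l (𝓝 0)) :
    Tendsto (fun x => solitonTau θ (X x / J) / solitonTau θ (X x)) l (𝓝 (∏ n ∈ I, (J n)⁻¹)) := by
  have hdet := det_leadingMatrix_cscMatrix_ne_zero hθ hθ' I
  have hden := tendsto_prod_inv_mul_solitonTau (θ := θ) hI hI'
  have hnum := tendsto_prod_inv_mul_solitonTau (θ := θ) (X := fun x => X x / J)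
    (fun n hn => by
      simpa only [Pi.div_apply, div_eq_mul_inv, Function.comp_def] using
        (tendsto_mul_right_cobounded (inv_ne_zero (hJ n))).comp (hI n hn))
    (fun n hn => by simpa using (hI' n hn).div_const (J n))
  have hratio := (hnum.div hden hdet).const_mul (∏ n ∈ I, (J n)⁻¹)
  rw [div_self hdet, mul_one] at hratio
  refine hratio.congr' ?_
  filter_upwards [(Finset.eventually_all I).2 fun n hn => (hI n hn).eventually_ne_cobounded 0]
    with x hx
  have hX : ∏ n ∈ I, (X x n)⁻¹ ≠ 0 :=
    Finset.prod_ne_zero_iff.2 fun n hn => inv_ne_zero (hx n hn)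
  have hprod : (∏ n ∈ I, (J n)⁻¹) * ∏ n ∈ I, ((X x / J) n)⁻¹ = ∏ n ∈ I, (X x n)⁻¹ := by
    rw [← Finset.prod_mul_distrib]
    refine Finset.prod_congr rfl fun n _ => ?_
    have hJn := hJ n
    rw [Pi.div_apply]
    field_simp
  rw [Pi.div_apply, ← mul_div_assoc, ← mul_assoc, hprod, mul_div_mul_left _ _ hX]

theorem norm_crossWeight {o o' : ℂ} (ho : conj o = o) (ho' : conj o' = o') (hn : ‖o‖ ≠ 1)
    (hn' : ‖o'‖ ≠ 1) (n : Fin N) : ‖crossWeight θ o o' n‖ = 1 := by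
  have hsq : ((‖crossWeight θ o o' n‖ ^ 2 : ℝ) : ℂ) = 1 := by
    rw [Complex.ofReal_pow, ← Complex.mul_conj', conj_crossWeight ho ho',
      mul_inv_cancel₀ (crossWeight_ne_zero θ hn hn' n)]
  exact (pow_eq_one_iff_of_nonneg (norm_nonneg _) two_ne_zero).1 (by exact_mod_cast hsq)

theorem waveState_addFirst_soliton {p : Times} (hp : p ∈ convergenceDomain d) (x : ℝ)
    (n : Fin N) : (waveState μ θ C d (p.addFirst x)).soliton n =
      (waveState μ θ C d p).soliton n * Complex.exp ((d.nu n 0 * x : ℝ) : ℂ) := by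
  have hsum : HasSum (fun k : ℕ => (d.nu n k : ℂ) * (p.addFirst x).pos k +
      (d.nuBar n k : ℂ) * (p.addFirst x).neg k) (solitonPhase d n p + (d.nu n 0 * x : ℝ)) := by
    refine ((hp.2 n).hasSum.add (hasSum_ite_eq 0 ((d.nu n 0 * x : ℝ) : ℂ))).congr_fun fun k => ?_
    rcases eq_or_ne k 0 with rfl | hk
    · simp only [Times.addFirst, if_pos, Complex.ofReal_mul]
      ring
    · simp [Times.addFirst, hk]
  have hphase : solitonPhase d n (p.addFirst x) = solitonPhase d n p + (d.nu n 0 * x : ℝ) :=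
    hsum.tsum_eq
  simp only [waveState]
  rw [hphase, mul_assoc, ← Complex.exp_add]
  ring_nf

theorem tendsto_mul_exp_cobounded {α : Type*} {l : Filter α} {f : α → ℝ} (hf : Tendsto f l atTop)
    {A : ℂ} (hA : A ≠ 0) :
    Tendsto (fun x => A * Complex.exp (f x)) l (Bornology.cobounded ℂ) := by
  refine (tendsto_mul_left_cobounded hA).comp (tendsto_norm_atTop_iff_cobounded.1 ?_)
  simpa only [Complex.norm_exp_ofReal, Function.comp_def] using Real.tendsto_exp_atTop.comp hf

theorem tendsto_mul_exp_zero {α : Type*} {l : Filter α} {f : α → ℝ} (hf : Tendsto f l atBot)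
    (A : ℂ) : Tendsto (fun x => A * Complex.exp (f x)) l (𝓝 0) := by
  have hexp : Tendsto (fun x => Complex.exp (f x)) l (𝓝 0) := by
    rw [tendsto_zero_iff_norm_tendsto_zero]
    simpa only [Complex.norm_exp_ofReal, Function.comp_def] using Real.tendsto_exp_atBot.comp hf
  simpa using hexp.const_mul A

open Classical in
theorem exists_tendsto_solitonU_div (hμ : ‖(μ : ℂ)‖ ≠ 1) (hU₀ : U₀ ≠ 0)
    (hθ : ∀ m n, Real.sin ((θ m + θ n) / 2) ≠ 0)
    (hθ' : ∀ m n, m ≠ n → Real.sin ((θ m - θ n) / 2) ≠ 0) {l : Filter ℝ}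
    (hl : ∀ n, Tendsto (fun x => d.nu n 0 * x) l atTop ∨ Tendsto (fun x => d.nu n 0 * x) l atBot) :
    ∃ w : ℂ, ‖w‖ = 1 ∧ ∀ p ∈ convergenceDomain d,
      Tendsto (fun x : ℝ => solitonU μ U₀ θ C d (p.addFirst x) /
        (U₀ * Complex.exp (Complex.I * phase d (p.addFirst x)))) l (𝓝 w) := by
  let I := Finset.univ.filter fun n => C n ≠ 0 ∧ Tendsto (fun x => d.nu n 0 * x) l atTop
  refine ⟨∏ n ∈ I, (crossWeight θ 0 μ n)⁻¹, ?_, fun p hp => ?_⟩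
  · rw [norm_prod]
    refine Finset.prod_eq_one fun n _ => ?_
    rw [norm_inv, norm_crossWeight (map_zero _) (Complex.conj_ofReal μ) (by simp) hμ, inv_one]
  let X (x : ℝ) := (waveState μ θ C d (p.addFirst x)).soliton
  have hfield (x : ℝ) : solitonU μ U₀ θ C d (p.addFirst x) /
      (U₀ * Complex.exp (Complex.I * phase d (p.addFirst x))) =
        solitonTau θ (X x / crossWeight θ 0 μ) / solitonTau θ (X x) := by
    rw [solitonU_eq_field hμ]
    simp only [field, weight_zero, mul_one]
    exact mul_div_cancel_left₀ _ (mul_ne_zero hU₀ (Complex.exp_ne_zero _))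
  simp only [hfield]
  refine tendsto_solitonTau_div_solitonTau hθ hθ' (crossWeight_ne_zero θ (by simp) hμ)
    (fun n hn => ?_) fun n hn => ?_
  · obtain ⟨hC, htop⟩ := (Finset.mem_filter.1 hn).2
    simp only [X, waveState_addFirst_soliton hp]
    exact tendsto_mul_exp_cobounded htop
      (mul_ne_zero (Complex.ofReal_ne_zero.2 hC) (Complex.exp_ne_zero _))
  · simp only [X, waveState_addFirst_soliton hp]
    by_cases hC : C n = 0
    · simpa [waveState, hC] using tendsto_const_nhds
    · have hbot := (hl n).resolve_left fun htop =>
        hn (Finset.mem_filter.2 ⟨Finset.mem_univ n, hC, htop⟩)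
      exact tendsto_mul_exp_zero hbot _

theorem hasNonvanishingBoundary_solitonU (hμ₀ : μ ≠ 0) (hμ₁ : μ ^ 2 ≠ 1) (hc : c ≠ 0)
    (hU₀ : U₀ ≠ 0) (hθ : ∀ m n, Real.sin ((θ m + θ n) / 2) ≠ 0)
    (hθ' : ∀ m n, m ≠ n → Real.sin ((θ m - θ n) / 2) ≠ 0) (hd : IsDispersion μ c θ d) :
    HasNonvanishingBoundary U₀ d (solitonU μ U₀ θ C d) := by
  have hb : IsBasePair (0 : ℂ) μ := by simpa using isBasePair_zero hμ₀ hμ₁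
  have hν (n : Fin N) : d.nu n 0 ≠ 0 :=
    ((isDispersion_iff hμ₀ hμ₁ hc).1 hd).1.nu_zero_ne_zero
      (neg_ne_zero.2 (mul_ne_zero hc (pow_ne_zero 2 hμ₀))) (isBasePair_zero hμ₀ hμ₁)
      (by simpa only [add_self_div_two] using hθ n n)
  obtain ⟨wPlus, hPlus, hlimPlus⟩ := exists_tendsto_solitonU_div (C := C) (d := d)
    hb.norm_right hU₀ hθ hθ' (l := atTop) fun n => (hν n).lt_or_gt.symm.imp
      (fun h => tendsto_id.const_mul_atTop h) fun h => tendsto_id.const_mul_atTop_of_neg h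
  obtain ⟨wMinus, hMinus, hlimMinus⟩ := exists_tendsto_solitonU_div (C := C) (d := d)
    hb.norm_right hU₀ hθ hθ' (l := atBot) fun n => (hν n).lt_or_gt.imp
      (fun h => tendsto_id.const_mul_atBot_of_neg h) fun h => tendsto_id.const_mul_atBot h
  exact ⟨wPlus, wMinus, hPlus, hMinus, fun p hp _ => ⟨hlimPlus p hp, hlimMinus p hp⟩⟩

end Boundary

theorem reflect_of_isReal {p : Times} (hp : p.IsReal) (f : Times → ℂ) :
    reflect f p = conj (f p) := by
  rw [reflect, show p.conj = p from hp]

theorem inv_sq_norm_mul_mul_conj {U₀ : ℂ} (hU₀ : U₀ ≠ 0) :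
    (((‖U₀‖ ^ 2)⁻¹ : ℝ) : ℂ) * (U₀ * conj U₀) = 1 := by
  have hsq : ‖U₀‖ ^ 2 ≠ 0 := pow_ne_zero 2 (norm_ne_zero_iff.2 hU₀)
  rw [Complex.mul_conj, Complex.normSq_eq_norm_sq, ← Complex.ofReal_mul, inv_mul_cancel₀ hsq,
    Complex.ofReal_one]

end DNLS

theorem proposition6 {N : ℕ} (μ : ℝ) (hμ₀ : μ ≠ 0) (hμ₁ : μ ^ 2 ≠ 1) (U₀ : ℂ) (hU₀ : U₀ ≠ 0)
    (θ : Fin N → ℝ) (hθ : ∀ m n, Real.sin ((θ m + θ n) / 2) ≠ 0) :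
    (∃ d : DNLS.Dispersion N, DNLS.IsDispersion μ ((‖U₀‖ ^ 2)⁻¹) θ d) ∧
    ∀ d : DNLS.Dispersion N, DNLS.IsDispersion μ ((‖U₀‖ ^ 2)⁻¹) θ d →
      ∀ C : Fin N → ℝ,
        DNLS.IsShiftStable (DNLS.regularDomain μ θ C d) ∧
        (∃ V u v : DNLS.Times → ℂ,
          V = DNLS.reflect (DNLS.solitonU μ U₀ θ C d) ∧
          (∀ p : DNLS.Times, p.IsReal →
            V p = starRingEnd ℂ (DNLS.solitonU μ U₀ θ C d p) ∧ v p = starRingEnd ℂ (u p)) ∧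
          ∃ r : ℝ, 0 < r ∧
            DNLS.IsExtendedDNLSH (DNLS.regularDomain μ θ C d) r
              (DNLS.solitonU μ U₀ θ C d) V u v) ∧
        ((∀ m n, m ≠ n → Real.sin ((θ m - θ n) / 2) ≠ 0) →
          DNLS.HasNonvanishingBoundary U₀ d (DNLS.solitonU μ U₀ θ C d)) := by
  have hc : (‖U₀‖ ^ 2)⁻¹ ≠ 0 := inv_ne_zero (pow_ne_zero 2 (norm_ne_zero_iff.2 hU₀))
  have hsin (n : Fin N) : Real.sin (θ n) ≠ 0 := by simpa only [add_self_div_two] using hθ n n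
  refine ⟨DNLS.exists_isDispersion hμ₀ hμ₁ hc hsin, fun d hd C =>
    ⟨DNLS.isShiftStable_regularDomain hμ₀ hμ₁ hc hd, ?_, fun hθ' =>
      DNLS.hasNonvanishingBoundary_solitonU hμ₀ hμ₁ hc hU₀ hθ hθ' hd⟩⟩
  exact ⟨_, DNLS.companionU μ ((‖U₀‖ ^ 2)⁻¹) U₀ θ C d, DNLS.reflect (DNLS.companionU _ _ _ θ C d),
    rfl, fun p hp => ⟨DNLS.reflect_of_isReal hp _, DNLS.reflect_of_isReal hp _⟩,
    DNLS.exists_isExtendedDNLSH hθ hμ₀ hμ₁ (DNLS.inv_sq_norm_mul_mul_conj hU₀) hd⟩
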